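/- Let $d\ge 1$, $\alpha\in(0,2)$, $p>1$, $m>0$, $\gamma>1$ and $p'=\frac{p}{p-1}$. For each $\varepsilon>0$ let the kernel $\Lambda^\varepsilon:\mathbb R^d\times\mathbb R^d\to(0,\infty)$ be given in one of the following two ways. (P1) $\Lambda^\varepsilon(x,y)=\lambda(x/\varepsilon)\,\mu(y/\varepsilon)$, where $\lambda,\mu:\mathbb R^d\to\mathbb R$ are measurable, $1$-periodic in each coordinate direction, and take values in $[\gamma^{-1},\gamma]$. In this case put $\nu^\varepsilon(x)=\mu(x/\varepsilon)/\lambda(x/\varepsilon)$ and $$\Lambda^{\rm eff}(x,y)=\Big(\int_{[0,1]^d}\frac{\mu(\xi)}{\lambda(\xi)}\,d\xi\Big)^{-1}\Big(\int_{[0,1]^d}\mu(\xi)\,d\xi\Big)^2 .$$ (P2) $\Lambda^\varepsilon(x,y)=\Lambda(x,y,x/\varepsilon,y/\varepsilon)$, where $\Lambda(x,y,\xi,\eta)$ is continuous in $(x,y)$ for all fixed $(\xi,\eta)$, is measurable in $(\xi,\eta)$ for all fixed $(x,y)$, is $1$-periodic in each coordinate direction of $\xi$ and of $\eta$, takes values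 in $[\gamma^{-1},\gamma]$, and satisfies $\Lambda(x,y,\xi,\eta)=\Lambda(y,x,\eta,\xi)$ for all $x,y,\xi,\eta\in\mathbb R^d$. In this case put $\nu^\varepsilon=1$ and $$\Lambda^{\rm eff}(x,y)=\int_{[0,1]^d}\int_{[0,1]^d}\Lambda(x,y,\xi,\eta)\,d\xi\,d\eta .$$ Let $W^{\alpha/p,p}(\mathbb R^d)$ be the space of all $u\in L^p(\mathbb R^d)$ with $[u]^p=\iint\frac{|u(y)-u(x)|^p}{|x-y|^{d+\alpha}}\,dx\,dy<\infty$, with norm $(\|u\|_{L^p}^p+[u]^p)^{1/p}$. (For $\alpha<p$ this is the usual fractional Sobolev space; for $\alpha\ge p$ it is $\{0\}$ and the assertion below is trivial.) For a measurable kernel $A(x,y)$ and a weight $\nu(x)$, both bounded above and below by positive constants, with $\nu(x)A(x,y)$ symmetric in $(x,y)$, a (weak) solution of $$\int_{\mathbb R^d}\frac{|u(y)-u(x)|^{p-2}(u(y)-u(x))}{|x-y|^{d+\alpha}}A(x,y)\,dy-m|u(x)|^{p-2}u(x)=f(x)\qquad(x\in\mathbb R^d)$$ with respect to $\nu$ is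 a function $u\in W^{\alpha/p,p}(\mathbb R^d)$ such that for all $v\in W^{\alpha/p,p}(\mathbb R^d)$ $$-\frac12\iint\frac{|u(y)-u(x)|^{p-2}(u(y)-u(x))(v(y)-v(x))}{|x-y|^{d+\alpha}}\,\nu(x)A(x,y)\,dx\,dy-m\int|u|^{p-2}u\,v\,\nu\,dx=\int f\,v\,\nu\,dx .$$ Then for every $f\in L^{p'}(\mathbb R^d)$ and every $\varepsilon>0$ this equation with $A=\Lambda^\varepsilon$, $\nu=\nu^\varepsilon$ has a unique solution $u^\varepsilon$; the equation with $A=\Lambda^{\rm eff}$, $\nu=1$ has a unique solution $u^0$; and, as $\varepsilon\to0^+$, $u^\varepsilon\to u^0$ strongly in $L^p(\mathbb R^d)$ and weakly in $W^{\alpha/p,p}(\mathbb R^d)$. -/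

import Mathlib

open MeasureTheory Filter Topology

noncomputable section

namespace NonlocalHomogenization

/-- `ℝ^d` with the Euclidean norm and Lebesgue measure. -/
abbrev Rd (d : ℕ) : Type := EuclideanSpace ℝ (Fin d)

/-- The unit cube `[0,1]^d`. -/
def unitCube (d : ℕ) : Set (Rd d) := {ξ | ∀ i, ξ i ∈ Set.Icc (0 : ℝ) 1}

/-- `1`-periodicity in each coordinate direction. -/
def UnitPeriodic {d : ℕ} (g : Rd d → ℝ) : Prop :=
  ∀ (i : Fin d) (ξ : Rd d), g (ξ + EuclideanSpace.single i 1) = g ξ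

/-- The two kinds of oscillating coefficients: a product `lam (x/ε) * mu (y/ε)`, or a locally
periodic function `Λ (x, y, x/ε, y/ε)`. -/
inductive Coefficient (d : ℕ) : Type
  | product (lam mu : Rd d → ℝ) : Coefficient d
  | locallyPeriodic (Λ : Rd d → Rd d → Rd d → Rd d → ℝ) : Coefficient d

/-- The assumptions on the coefficients, with ellipticity constant `γ`.
`AEMeasurable` with respect to Lebesgue measure is Lebesgue measurability. -/
def Coefficient.Admissible {d : ℕ} (γ : ℝ) : Coefficient d → Prop
  | .product lam mu =>
      AEMeasurable lam volume ∧ AEMeasurable mu volume ∧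
      UnitPeriodic lam ∧ UnitPeriodic mu ∧
      (∀ ξ, γ⁻¹ ≤ lam ξ ∧ lam ξ ≤ γ) ∧ (∀ η, γ⁻¹ ≤ mu η ∧ mu η ≤ γ)
  | .locallyPeriodic Λ =>
      (∀ ξ η, Continuous fun z : Rd d × Rd d => Λ z.1 z.2 ξ η) ∧
      (∀ x y, AEMeasurable (fun w : Rd d × Rd d => Λ x y w.1 w.2) volume) ∧
      (∀ x y η, UnitPeriodic fun ξ => Λ x y ξ η) ∧
      (∀ x y ξ, UnitPeriodic fun η => Λ x y ξ η) ∧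
      (∀ x y ξ η, Λ x y ξ η = Λ y x η ξ) ∧
      (∀ x y ξ η, γ⁻¹ ≤ Λ x y ξ η ∧ Λ x y ξ η ≤ γ)

/-- The kernel `Λ^ε (x, y)`. -/
def Coefficient.kernel {d : ℕ} (ε : ℝ) : Coefficient d → Rd d → Rd d → ℝ
  | .product lam mu => fun x y => lam (ε⁻¹ • x) * mu (ε⁻¹ • y)
  | .locallyPeriodic Λ => fun x y => Λ x y (ε⁻¹ • x) (ε⁻¹ • y)

/-- The weight `ν^ε` for which `ν^ε (x) Λ^ε (x, y)` is symmetric in `x, y`: it is `μ/λ` at `x/ε`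
for product coefficients and `1` for (symmetric) locally periodic ones. -/
def Coefficient.weight {d : ℕ} (ε : ℝ) : Coefficient d → Rd d → ℝ
  | .product lam mu => fun x => mu (ε⁻¹ • x) / lam (ε⁻¹ • x)
  | .locallyPeriodic _ => fun _ => 1

/-- The effective kernel `Λ^eff (x, y)`. -/
def Coefficient.effective {d : ℕ} : Coefficient d → Rd d → Rd d → ℝ
  | .product lam mu => fun _ _ =>
      (∫ ξ in unitCube d, mu ξ / lam ξ)⁻¹ * (∫ ξ in unitCube d, mu ξ) ^ 2
  | .locallyPeriodic Λ => fun x y =>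
      ∫ η in unitCube d, ∫ ξ in unitCube d, Λ x y ξ η

/-- The Gagliardo energy `∬ |u(y) - u(x)|^p / |x - y|^(d + α) dx dy`, a value in `[0, ∞]`. -/
def gagliardoEnergy {d : ℕ} (α p : ℝ) (u : Rd d → ℝ) : ENNReal :=
  ∫⁻ z : Rd d × Rd d, ENNReal.ofReal (|u z.2 - u z.1| ^ p / ‖z.1 - z.2‖ ^ ((d : ℝ) + α))

lemma gagliardoEnergy_congr {d : ℕ} (α p : ℝ) {u v : Rd d → ℝ} (h : u =ᵐ[volume] v) :
    gagliardoEnergy α p u = gagliardoEnergy α p v := by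
  refine lintegral_congr_ae ?_
  have h1 : ∀ᵐ z : Rd d × Rd d, u z.1 = v z.1 := Measure.quasiMeasurePreserving_fst.ae h
  have h2 : ∀ᵐ z : Rd d × Rd d, u z.2 = v z.2 := Measure.quasiMeasurePreserving_snd.ae h
  filter_upwards [h1, h2] with z hz1 hz2
  rw [hz1, hz2]

lemma gagliardoEnergy_add_lt_top {d : ℕ} (α : ℝ) {p : ℝ} (hp : 1 < p) {u v : Rd d → ℝ}
    (hum : AEStronglyMeasurable u volume)
    (hu : gagliardoEnergy α p u < ⊤) (hv : gagliardoEnergy α p v < ⊤) :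
    gagliardoEnergy α p (u + v) < ⊤ := by
  have hmeas : AEMeasurable (fun z : Rd d × Rd d =>
      ENNReal.ofReal (|u z.2 - u z.1| ^ p / ‖z.1 - z.2‖ ^ ((d : ℝ) + α))) volume := by
    have h1 : AEMeasurable (fun z : Rd d × Rd d => u z.1) volume :=
      hum.aemeasurable.comp_quasiMeasurePreserving Measure.quasiMeasurePreserving_fst
    have h2 : AEMeasurable (fun z : Rd d × Rd d => u z.2) volume :=
      hum.aemeasurable.comp_quasiMeasurePreserving Measure.quasiMeasurePreserving_snd
    have h3 : AEMeasurable (fun z : Rd d × Rd d => |u z.2 - u z.1| ^ p) volume :=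
      (measurable_norm.comp_aemeasurable (h2.sub h1)).pow_const p
    exact (h3.div (by fun_prop)).ennreal_ofReal
  have key : gagliardoEnergy α p (u + v) ≤
      ENNReal.ofReal (2 ^ (p - 1)) * (gagliardoEnergy α p u + gagliardoEnergy α p v) := by
    unfold gagliardoEnergy
    rw [← lintegral_add_left' hmeas, ← lintegral_const_mul' _ _ ENNReal.ofReal_ne_top]
    refine lintegral_mono fun z => ?_
    rw [← ENNReal.ofReal_add (by positivity) (by positivity),
      ← ENNReal.ofReal_mul (by positivity)]
    refine ENNReal.ofReal_le_ofReal ?_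
    rw [← add_div, ← mul_div_assoc]
    refine div_le_div_of_nonneg_right ?_ (by positivity)
    have h1 : |(u + v) z.2 - (u + v) z.1| ≤ |u z.2 - u z.1| + |v z.2 - v z.1| := by
      have : (u + v) z.2 - (u + v) z.1 = (u z.2 - u z.1) + (v z.2 - v z.1) := by
        simp only [Pi.add_apply]; ring
      rw [this]
      exact abs_add_le _ _
    calc |(u + v) z.2 - (u + v) z.1| ^ p
        ≤ (|u z.2 - u z.1| + |v z.2 - v z.1|) ^ p :=
          Real.rpow_le_rpow (abs_nonneg _) h1 (by linarith)
      _ ≤ 2 ^ (p - 1) * (|u z.2 - u z.1| ^ p + |v z.2 - v z.1| ^ p) :=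
          mod_cast NNReal.rpow_add_le_mul_rpow_add_rpow
            ⟨|u z.2 - u z.1|, abs_nonneg _⟩ ⟨|v z.2 - v z.1|, abs_nonneg _⟩ hp.le
  exact key.trans_lt (ENNReal.mul_lt_top ENNReal.ofReal_lt_top (ENNReal.add_lt_top.2 ⟨hu, hv⟩))

lemma gagliardoEnergy_smul {d : ℕ} (α p : ℝ) (c : ℝ) (u : Rd d → ℝ) :
    gagliardoEnergy α p (c • u) = ENNReal.ofReal (|c| ^ p) * gagliardoEnergy α p u := by
  unfold gagliardoEnergy
  rw [← lintegral_const_mul' _ _ ENNReal.ofReal_ne_top]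
  refine lintegral_congr fun z => ?_
  rw [← ENNReal.ofReal_mul (by positivity), ← mul_div_assoc,
    ← Real.mul_rpow (abs_nonneg _) (abs_nonneg _), ← abs_mul, mul_sub]
  rfl

lemma gagliardoEnergy_zero {d : ℕ} (α : ℝ) {p : ℝ} (hp : 1 < p) :
    gagliardoEnergy α p (0 : Rd d → ℝ) = 0 := by
  simp [gagliardoEnergy, Real.zero_rpow (by linarith : p ≠ 0)]

/-- The fractional Sobolev space `W^{α/p,p}(ℝ^d)`: the `u ∈ L^p(ℝ^d)` of finite Gagliardo energy
(the exponent `d + α` is `d + s * p` with `s = α / p`). For `α ≥ p` this space is `{0}`. -/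
def Sobolev (d : ℕ) (α p : ℝ) (hp : 1 < p) :
    Submodule ℝ (Lp ℝ (ENNReal.ofReal p) (volume : Measure (Rd d))) where
  carrier := {u | gagliardoEnergy α p u < ⊤}
  add_mem' {u v} hu hv := by
    rw [Set.mem_ofPred_eq, gagliardoEnergy_congr α p (Lp.coeFn_add u v)]
    exact gagliardoEnergy_add_lt_top α hp (Lp.aestronglyMeasurable u) hu hv
  zero_mem' := by
    rw [Set.mem_ofPred_eq, gagliardoEnergy_congr α p (Lp.coeFn_zero _ _ _),
      gagliardoEnergy_zero α hp]
    exact ENNReal.zero_lt_top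
  smul_mem' c u hu := by
    rw [Set.mem_ofPred_eq, gagliardoEnergy_congr α p (Lp.coeFn_smul c u), gagliardoEnergy_smul]
    exact ENNReal.mul_lt_top ENNReal.ofReal_lt_top hu

/-- The norm of `W^{α/p,p}(ℝ^d)`. -/
def sobolevNorm {d : ℕ} {α p : ℝ} {hp : 1 < p} (u : Sobolev d α p hp) : ℝ :=
  (‖u.1‖ ^ p + (gagliardoEnergy α p u.1).toReal) ^ (1 / p)

/-- Weak convergence in `W^{α/p,p}(ℝ^d)`: convergence under every bounded linear functional. -/
def WeakTendsto {ι : Type*} {d : ℕ} {α p : ℝ} {hp : 1 < p}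
    (u : ι → Sobolev d α p hp) (l : Filter ι) (u₀ : Sobolev d α p hp) : Prop :=
  ∀ ℓ : Sobolev d α p hp →ₗ[ℝ] ℝ, (∃ C : ℝ, ∀ v, |ℓ v| ≤ C * sobolevNorm v) →
    Tendsto (fun i => ℓ (u i)) l (𝓝 (ℓ u₀))

/-- The function `t ↦ |t|^(p-2) t` (with value `0` at `0`). -/
def signedPow (p t : ℝ) : ℝ := |t| ^ (p - 2) * t

/-- The form
`½ ∬ a(x,y) |u(y)-u(x)|^(p-2) (u(y)-u(x)) (v(y)-v(x)) / |x-y|^(d+α) dx dy`. -/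
def energyForm {d : ℕ} (α p : ℝ) (a : Rd d → Rd d → ℝ) (u v : Rd d → ℝ) : ℝ :=
  (1 / 2) * ∫ z : Rd d × Rd d,
    a z.1 z.2 * signedPow p (u z.2 - u z.1) * (v z.2 - v z.1) / ‖z.1 - z.2‖ ^ ((d : ℝ) + α)

/-- `u ∈ W^{α/p,p}` is a weak solution of `L u - m |u|^(p-2) u = f`, where
`L u (x) = ∫ |u(y)-u(x)|^(p-2) (u(y)-u(x)) |x-y|^(-d-α) Λ(x,y) dy` and `ν` is a weight for which
`ν(x) Λ(x,y)` is symmetric. The equation is multiplied by `v ν` and integrated; by the symmetry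
of `ν(x) Λ(x,y)`, the pairing of `L u` with `v ν` is minus the energy form with coefficient
`ν(x) Λ(x,y)`. -/
def IsWeakSolution {d : ℕ} {α p : ℝ} {hp : 1 < p} (m : ℝ) (Λ : Rd d → Rd d → ℝ) (ν : Rd d → ℝ)
    (f : Rd d → ℝ) (u : Sobolev d α p hp) : Prop :=
  ∀ v : Sobolev d α p hp,
    -energyForm α p (fun x y => ν x * Λ x y) u.1 v.1
      - m * ∫ x, signedPow p (u.1 x) * v.1 x * ν x = ∫ x, f x * v.1 x * ν x

end NonlocalHomogenization

end

/-!
Sending `u` to the pair `(u, u y - u x)` identifies the Sobolev space with a closed subspace of an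
`L^p` space over a disjoint union, on which weak solutions are the minimisers of a weighted
`p`-energy; strict convexity and coercivity give existence and uniqueness. The oscillating
coefficients converge weak-star in `L^∞` to their means over the period cell. Tested against `v`,
the residual of the oscillating equation at the effective solution `u⁰` is linear in the
coefficients. After truncation and integration in one variable it consists of terms `∫ B^ε v` with
`B^ε` dominated in `L^q`, `1 / p + 1 / q = 1`, and weakly null. Averaging `B^ε` over balls of radius
`r` changes such a term by at most `C r^(α/p) ‖v‖`, and the averages tend to zero in `L^q`, so the
residual tends to zero uniformly over the unit ball of `v`. Uniform monotonicity of the weighted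
form then turns this into strong convergence `u^ε → u⁰` in the Sobolev norm.
-/

noncomputable section

namespace NonlocalHomogenization

/-! ### Power nonlinearities -/

section Powers

variable {p : ℝ}

lemma abs_signedPow (hp : p ≠ 1) (t : ℝ) : |signedPow p t| = |t| ^ (p - 1) := by
  rcases eq_or_ne t 0 with rfl | ht
  · simp [signedPow, Real.zero_rpow (sub_ne_zero.2 hp)]
  · rw [signedPow, abs_mul, abs_of_nonneg (by positivity), ← Real.rpow_add_one (abs_ne_zero.2 ht)]
    congr 1; ring

lemma abs_signedPow_rpow_conjExponent (hp : p ≠ 1) (t : ℝ) :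
    |signedPow p t| ^ (p / (p - 1)) = |t| ^ p := by
  rw [abs_signedPow hp, ← Real.rpow_mul (abs_nonneg _), mul_div_cancel₀ _ (sub_ne_zero.2 hp)]

lemma signedPow_mul_self (hp : p ≠ 0) (t : ℝ) : signedPow p t * t = |t| ^ p := by
  rcases eq_or_ne t 0 with rfl | ht
  · simp [Real.zero_rpow hp]
  · have ht' := abs_ne_zero.2 ht
    rw [signedPow, mul_assoc, ← abs_mul_abs_self, ← mul_assoc, ← Real.rpow_add_one ht',
      ← Real.rpow_add_one ht']
    congr 1; ring

lemma continuous_signedPow (hp : 1 < p) : Continuous (signedPow p) := by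
  refine continuous_iff_continuousAt.2 fun t => ?_
  rcases eq_or_ne t 0 with rfl | ht
  · have h : Tendsto (fun t : ℝ => |t| ^ (p - 1)) (𝓝 0) (𝓝 (|0| ^ (p - 1))) :=
      (continuous_abs.rpow_const fun _ => Or.inr (by linarith)).tendsto 0
    rw [abs_zero, Real.zero_rpow (by linarith)] at h
    rw [ContinuousAt, show signedPow p 0 = 0 by simp [signedPow],
      tendsto_zero_iff_abs_tendsto_zero]
    exact h.congr fun t => (abs_signedPow hp.ne' t).symm
  · exact (continuous_abs.continuousAt.rpow_const (Or.inl (abs_ne_zero.2 ht))).mul continuousAt_id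

lemma continuous_abs_rpow (hp : 0 ≤ p) : Continuous fun t : ℝ => |t| ^ p :=
  continuous_abs.rpow_const fun _ => Or.inr hp

lemma abs_rpow_tangent_le (hp : 1 < p) (a b : ℝ) :
    |a| ^ p / p + signedPow p a * (b - a) ≤ |b| ^ p / p := by
  have hpq := Real.HolderConjugate.conjExponent hp
  have young : signedPow p a * b ≤ |b| ^ p / p + |a| ^ p / p.conjExponent := by
    calc signedPow p a * b ≤ |b| * |signedPow p a| := by
          rw [← abs_mul, mul_comm]; exact le_abs_self _
      _ ≤ |b| ^ p / p + |signedPow p a| ^ p.conjExponent / p.conjExponent :=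
          Real.young_inequality_of_nonneg (abs_nonneg b) (abs_nonneg _) hpq
      _ = |b| ^ p / p + |a| ^ p / p.conjExponent := by
          rw [Real.conjExponent, abs_signedPow_rpow_conjExponent hp.ne']
  have split : |a| ^ p = |a| ^ p / p + |a| ^ p / p.conjExponent := by
    rw [div_eq_mul_inv, div_eq_mul_inv, ← mul_add, hpq.inv_add_inv_eq_one, mul_one]
  rw [mul_sub, signedPow_mul_self (by linarith)]
  linarith

/-- The defect in the midpoint convexity inequality for `t ↦ |t| ^ p`. It measures the uniform
convexity of the `p`-th power of the `L^p` norm, for all `p > 1` at once. -/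
def midpointDefect (p a b : ℝ) : ℝ := |a| ^ p + |b| ^ p - 2 * |(a + b) / 2| ^ p

lemma midpointDefect_le (hp : 1 < p) (a b : ℝ) :
    midpointDefect p a b ≤ p / 2 * ((signedPow p a - signedPow p b) * (a - b)) := by
  have hp0 : 0 < p := by linarith
  have ha := mul_le_mul_of_nonneg_left (abs_rpow_tangent_le hp a ((a + b) / 2)) hp0.le
  have hb := mul_le_mul_of_nonneg_left (abs_rpow_tangent_le hp b ((a + b) / 2)) hp0.le
  rw [mul_add, mul_div_cancel₀ _ hp0.ne', mul_div_cancel₀ _ hp0.ne'] at ha hb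
  unfold midpointDefect
  linear_combination ha + hb

lemma midpointDefect_self (p a : ℝ) : midpointDefect p a a = 0 := by
  rw [midpointDefect, add_self_div_two]; ring

lemma midpointDefect_pos (hp : 1 < p) {a b : ℝ} (hab : a ≠ b) : 0 < midpointDefect p a b := by
  have hp0 : 0 < p := by linarith
  unfold midpointDefect
  by_cases h : |a| = |b|
  · obtain rfl : a = -b := (abs_eq_abs.1 h).resolve_left hab
    have hb : b ≠ 0 := by rintro rfl; simp at hab
    have : 0 < |b| ^ p := Real.rpow_pos_of_pos (abs_pos.2 hb) p
    simp [Real.zero_rpow hp0.ne', this]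
  · have strict := (strictConvexOn_rpow hp).2 (Set.mem_Ici.2 (abs_nonneg a))
      (Set.mem_Ici.2 (abs_nonneg b)) h one_half_pos one_half_pos (add_halves 1)
    simp only [smul_eq_mul] at strict
    have triangle : |(a + b) / 2| ^ p ≤ (1 / 2 * |a| + 1 / 2 * |b|) ^ p := by
      refine Real.rpow_le_rpow (abs_nonneg _) ?_ hp0.le
      rw [abs_div, abs_two]
      linarith [abs_add_le a b]
    linarith

lemma midpointDefect_nonneg (hp : 1 < p) (a b : ℝ) : 0 ≤ midpointDefect p a b := by
  rcases eq_or_ne a b with rfl | hab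
  · exact (midpointDefect_self p a).ge
  · exact (midpointDefect_pos hp hab).le

lemma midpointDefect_mul {c : ℝ} (hc : 0 ≤ c) (a b : ℝ) :
    midpointDefect p (c * a) (c * b) = c ^ p * midpointDefect p a b := by
  unfold midpointDefect
  rw [show (c * a + c * b) / 2 = c * ((a + b) / 2) by ring]
  simp only [abs_mul, abs_of_nonneg hc, Real.mul_rpow hc (abs_nonneg _)]
  ring

lemma exists_forall_le_mul_of_isCompact {X : Type*} [TopologicalSpace X] {K : Set X}
    (hK : IsCompact K) {g h : X → ℝ} (hg : Continuous g) (hh : Continuous h)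
    (hg0 : ∀ x ∈ K, 0 ≤ g x) (hpos : ∀ x ∈ K, 0 ≤ h x → 0 < g x) :
    ∃ C, 0 ≤ C ∧ ∀ x ∈ K, h x ≤ C * g x := by
  have hS : IsCompact (K ∩ {x | 0 ≤ h x}) := hK.inter_right (isClosed_le continuous_const hh)
  have hcont : ContinuousOn (fun x => h x / g x) (K ∩ {x | 0 ≤ h x}) :=
    hh.continuousOn.div hg.continuousOn fun x hx => (hpos x hx.1 hx.2).ne'
  obtain ⟨C, hC⟩ := hS.bddAbove_image hcont
  refine ⟨|C|, abs_nonneg C, fun x hx => ?_⟩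
  rcases le_total 0 (h x) with h0 | h0
  · rw [← div_le_iff₀ (hpos x hx h0)]
    exact (hC ⟨x, ⟨hx, h0⟩, rfl⟩).trans (le_abs_self C)
  · exact h0.trans (mul_nonneg (abs_nonneg C) (hg0 x hx))

lemma exists_abs_sub_rpow_le_midpointDefect (hp : 1 < p) {δ : ℝ} (hδ : 0 < δ) :
    ∃ C, 0 ≤ C ∧ ∀ a b : ℝ,
      |a - b| ^ p ≤ δ * (|a| ^ p + |b| ^ p) + C * midpointDefect p a b := by
  have hp0 : 0 < p := by linarith
  have hpow := continuous_abs_rpow hp0.le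
  let h : ℝ × ℝ → ℝ := fun x => |x.1 - x.2| ^ p - δ * (|x.1| ^ p + |x.2| ^ p)
  have hh : Continuous h :=
    (hpow.comp (by fun_prop : Continuous fun x : ℝ × ℝ => x.1 - x.2)).sub
      (((hpow.comp continuous_fst).add (hpow.comp continuous_snd)).const_mul δ)
  have hdefect : Continuous fun x : ℝ × ℝ => midpointDefect p x.1 x.2 :=
    ((hpow.comp continuous_fst).add (hpow.comp continuous_snd)).sub
      ((hpow.comp (by fun_prop : Continuous fun x : ℝ × ℝ => (x.1 + x.2) / 2)).const_mul 2)
  obtain ⟨C, hC0, hC⟩ := exists_forall_le_mul_of_isCompact (isCompact_sphere (0 : ℝ × ℝ) 1)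
    hdefect hh (fun x _ => midpointDefect_nonneg hp _ _) fun ⟨a, b⟩ hx hab => by
      refine midpointDefect_pos hp fun hab' : a = b => ?_
      subst hab'
      have ha : a ≠ 0 := by rintro rfl; simp at hx
      have : 0 < |a| ^ p := Real.rpow_pos_of_pos (abs_pos.2 ha) p
      simp only [h, sub_self, abs_zero, Real.zero_rpow hp0.ne'] at hab
      nlinarith
  refine ⟨C, hC0, fun a b => ?_⟩
  -- Both sides are homogeneous of degree `p`, so the case of the unit sphere suffices.
  rcases eq_or_ne ((a, b) : ℝ × ℝ) 0 with hab | hab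
  · obtain ⟨rfl, rfl⟩ := Prod.mk_eq_zero.1 hab
    simp [midpointDefect, Real.zero_rpow hp0.ne']
  · set r := ‖((a, b) : ℝ × ℝ)‖⁻¹ with hr
    have hr0 : 0 < r := inv_pos.2 (norm_pos_iff.2 hab)
    have hsphere := hC (r * a, r * b) (by
      rw [← smul_eq_mul, ← smul_eq_mul, ← Prod.smul_mk, mem_sphere_zero_iff_norm, norm_smul,
        Real.norm_of_nonneg hr0.le, hr, inv_mul_cancel₀ (norm_ne_zero_iff.2 hab)])
    simp only [h, midpointDefect_mul hr0.le, ← mul_sub, abs_mul, abs_of_pos hr0,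
      Real.mul_rpow hr0.le (abs_nonneg _)] at hsphere
    refine le_of_mul_le_mul_left ?_ (Real.rpow_pos_of_pos hr0 p)
    linarith

lemma exists_mul_le_mul_rpow_add (hp : 1 < p) {c : ℝ} (hc : 0 < c) (K : ℝ) :
    ∃ K', ∀ t : ℝ, 0 ≤ t → K * t ≤ c * t ^ p + K' := by
  have hp0 : 0 < p := by linarith
  set a := (c * p) ^ (1 / p) with ha
  have ha0 : 0 < a := by positivity
  have hap : a ^ p = c * p := by
    rw [ha, ← Real.rpow_mul (by positivity), one_div_mul_cancel hp0.ne', Real.rpow_one]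
  refine ⟨|K / a| ^ p.conjExponent / p.conjExponent, fun t ht => ?_⟩
  calc K * t = a * t * (K / a) := by field_simp
    _ ≤ |a * t| ^ p / p + |K / a| ^ p.conjExponent / p.conjExponent :=
        Real.young_inequality _ _ (Real.HolderConjugate.conjExponent hp)
    _ = c * t ^ p + |K / a| ^ p.conjExponent / p.conjExponent := by
        rw [abs_of_nonneg (by positivity), Real.mul_rpow ha0.le ht, hap]
        field_simp

end Powers

/-! ### `L^p` estimates -/

section Lp

variable {Ω : Type*} [MeasurableSpace Ω] {ρ : Measure Ω} {p q C : ℝ} {w g v : Ω → ℝ}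

lemma norm_eq_lpNorm {r : ENNReal} (u : Lp ℝ r ρ) : ‖u‖ = lpNorm u r ρ := by
  rw [Lp.norm_def, toReal_eLpNorm (Lp.aestronglyMeasurable u)]

lemma lpNorm_rpow (hp : 0 < p) (hg : AEStronglyMeasurable g ρ) :
    lpNorm g (ENNReal.ofReal p) ρ ^ p = ∫ x, |g x| ^ p ∂ρ := by
  rw [lpNorm_eq_integral_norm_rpow_toReal (by simpa using hp) ENNReal.ofReal_ne_top hg,
    ENNReal.toReal_ofReal hp.le, ← Real.rpow_mul (integral_nonneg fun x => by positivity),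
    inv_mul_cancel₀ hp.ne', Real.rpow_one]
  rfl

lemma norm_rpow_eq_integral (hp : 0 < p) (u : Lp ℝ (ENNReal.ofReal p) ρ) :
    ‖u‖ ^ p = ∫ x, |u x| ^ p ∂ρ := by
  rw [norm_eq_lpNorm, lpNorm_rpow hp (Lp.aestronglyMeasurable u)]

lemma memLp_iff_integrable_abs_rpow (hp : 0 < p) (hg : AEStronglyMeasurable g ρ) :
    MemLp g (ENNReal.ofReal p) ρ ↔ Integrable (fun x => |g x| ^ p) ρ := by
  rw [← integrable_norm_rpow_iff hg (by simpa using hp) ENNReal.ofReal_ne_top,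
    ENNReal.toReal_ofReal hp.le]
  rfl

lemma integrable_abs_rpow (hp : 0 < p) (hg : MemLp g (ENNReal.ofReal p) ρ) :
    Integrable (fun x => |g x| ^ p) ρ :=
  (memLp_iff_integrable_abs_rpow hp hg.1).1 hg

lemma memLp_bdd_mul {r : ENNReal} (hw : AEStronglyMeasurable w ρ) (hwC : ∀ x, |w x| ≤ C)
    (hg : MemLp g r ρ) : MemLp (fun x => w x * g x) r ρ :=
  MemLp.of_le_mul hg (hw.mul hg.1) (.of_forall fun x => by
    rw [norm_mul]; exact mul_le_mul_of_nonneg_right (hwC x) (norm_nonneg _))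

lemma lpNorm_bdd_mul_le {r : ENNReal} (hwC : ∀ x, |w x| ≤ C) (hg : MemLp g r ρ) :
    lpNorm (fun x => w x * g x) r ρ ≤ C * lpNorm g r ρ := by
  rcases isEmpty_or_nonempty Ω with h | ⟨⟨x₀⟩⟩
  · simp
  have hC : 0 ≤ C := (abs_nonneg _).trans (hwC x₀)
  calc lpNorm (fun x => w x * g x) r ρ ≤ lpNorm (C • fun x => |g x|) r ρ :=
        lpNorm_mono_real (hg.abs.const_smul C) fun x => by
          rw [Real.norm_eq_abs, abs_mul]
          exact mul_le_mul_of_nonneg_right (hwC x) (abs_nonneg _)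
    _ = C * lpNorm g r ρ := by
        rw [lpNorm_const_smul, lpNorm_fun_abs hg.1, coe_nnnorm, Real.norm_of_nonneg hC]

lemma integrable_mul_of_holderConjugate (hpq : p.HolderConjugate q)
    (hg : MemLp g (ENNReal.ofReal q) ρ) (hv : MemLp v (ENNReal.ofReal p) ρ) :
    Integrable (fun x => g x * v x) ρ := by
  have := hpq.symm.ennrealOfReal
  exact hg.integrable_mul hv

lemma abs_integral_mul_le_lpNorm_mul_lpNorm (hpq : p.HolderConjugate q)
    (hg : MemLp g (ENNReal.ofReal q) ρ) (hv : MemLp v (ENNReal.ofReal p) ρ) :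
    |∫ x, g x * v x ∂ρ| ≤ lpNorm g (ENNReal.ofReal q) ρ * lpNorm v (ENNReal.ofReal p) ρ := by
  refine abs_integral_le_integral_abs.trans ?_
  simp only [abs_mul]
  refine (integral_mul_norm_le_Lp_mul_Lq hpq.symm hg hv).trans_eq ?_
  simp_rw [Real.norm_eq_abs, ← lpNorm_rpow hpq.symm.pos hg.1, ← lpNorm_rpow hpq.pos hv.1]
  rw [one_div, one_div, Real.rpow_rpow_inv lpNorm_nonneg hpq.symm.ne_zero,
    Real.rpow_rpow_inv lpNorm_nonneg hpq.ne_zero]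

lemma memLp_signedPow (hpq : p.HolderConjugate q) {u : Ω → ℝ}
    (hu : MemLp u (ENNReal.ofReal p) ρ) :
    MemLp (fun x => signedPow p (u x)) (ENNReal.ofReal q) ρ := by
  have hmeas : AEStronglyMeasurable (fun x => signedPow p (u x)) ρ :=
    (continuous_signedPow hpq.lt).comp_aestronglyMeasurable hu.1
  rw [memLp_iff_integrable_abs_rpow hpq.symm.pos hmeas]
  simp only [hpq.conjugate_eq, abs_signedPow_rpow_conjExponent hpq.lt.ne']
  exact integrable_abs_rpow hpq.pos hu

lemma lpNorm_signedPow (hpq : p.HolderConjugate q) {u : Ω → ℝ}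
    (hu : MemLp u (ENNReal.ofReal p) ρ) :
    lpNorm (fun x => signedPow p (u x)) (ENNReal.ofReal q) ρ =
      lpNorm u (ENNReal.ofReal p) ρ ^ (p - 1) := by
  have hq : lpNorm (fun x => signedPow p (u x)) (ENNReal.ofReal q) ρ ^ q =
      (lpNorm u (ENNReal.ofReal p) ρ ^ (p - 1)) ^ q := by
    rw [lpNorm_rpow hpq.symm.pos (memLp_signedPow hpq hu).1, ← Real.rpow_mul lpNorm_nonneg,
      hpq.sub_one_mul_conj, lpNorm_rpow hpq.pos hu.1]
    simp only [hpq.conjugate_eq, abs_signedPow_rpow_conjExponent hpq.lt.ne']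
  exact (Real.rpow_left_inj lpNorm_nonneg (Real.rpow_nonneg lpNorm_nonneg _)
    hpq.symm.ne_zero).1 hq

end Lp

/-! ### Monotone forms on `L^p` -/

section WeightedForm

variable {Ω : Type*} [MeasurableSpace Ω] {ρ : Measure Ω} {p c C : ℝ} {w : Ω → ℝ}

/-- `w` is a measurable coefficient with ellipticity bounds `0 < c ≤ w ≤ C`. -/
structure IsElliptic (ρ : Measure Ω) (c C : ℝ) (w : Ω → ℝ) : Prop where
  pos : 0 < c
  aestronglyMeasurable : AEStronglyMeasurable w ρ
  lower : ∀ x, c ≤ w x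
  upper : ∀ x, w x ≤ C

lemma IsElliptic.nonneg (hw : IsElliptic ρ c C w) (x : Ω) : 0 ≤ w x :=
  hw.pos.le.trans (hw.lower x)

lemma IsElliptic.abs_le (hw : IsElliptic ρ c C w) (x : Ω) : |w x| ≤ C :=
  (abs_of_nonneg (hw.nonneg x)).trans_le (hw.upper x)

lemma IsElliptic.integrable_mul (hw : IsElliptic ρ c C w) {g : Ω → ℝ} (hg : Integrable g ρ) :
    Integrable (fun x => w x * g x) ρ :=
  hg.bdd_mul hw.aestronglyMeasurable (.of_forall hw.abs_le)

/-- The energy `(1/p) ∫ w |u|^p` on `L^p`. -/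
def weightedEnergy (w : Ω → ℝ) (u : Lp ℝ (ENNReal.ofReal p) ρ) : ℝ :=
  ∫ x, w x * (|u x| ^ p / p) ∂ρ

/-- The form `∫ w |u|^(p-2) u v` on `L^p`, the derivative of the energy at `u` in direction `v`. -/
def weightedForm (w : Ω → ℝ) (u v : Lp ℝ (ENNReal.ofReal p) ρ) : ℝ :=
  ∫ x, w x * (signedPow p (u x) * v x) ∂ρ

lemma weightedForm_smul_right (w : Ω → ℝ) (u v : Lp ℝ (ENNReal.ofReal p) ρ) (t : ℝ) :
    weightedForm w u (t • v) = t * weightedForm w u v := by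
  rw [weightedForm, weightedForm, ← integral_const_mul]
  refine integral_congr_ae ?_
  filter_upwards [Lp.coeFn_smul t v] with x hx
  rw [hx, Pi.smul_apply, smul_eq_mul]; ring

lemma integrable_signedPow_mul (hp : 1 < p) {u v : Ω → ℝ} (hu : MemLp u (ENNReal.ofReal p) ρ)
    (hv : MemLp v (ENNReal.ofReal p) ρ) : Integrable (fun x => signedPow p (u x) * v x) ρ :=
  have hpq := Real.HolderConjugate.conjExponent hp
  integrable_mul_of_holderConjugate hpq (memLp_signedPow hpq hu) hv

lemma integrable_midpointDefect (hp : 0 < p) (u v : Lp ℝ (ENNReal.ofReal p) ρ) :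
    Integrable (fun x => midpointDefect p (u x) (v x)) ρ := by
  have hmid : MemLp (fun x => (u x + v x) / 2) (ENNReal.ofReal p) ρ := by
    simpa only [Pi.add_apply, div_eq_inv_mul] using
      ((Lp.memLp u).add (Lp.memLp v)).const_mul 2⁻¹
  exact ((integrable_abs_rpow hp (Lp.memLp u)).add (integrable_abs_rpow hp (Lp.memLp v))).sub
    ((integrable_abs_rpow hp hmid).const_mul 2)

lemma abs_weightedForm_le (hp : 1 < p) (hw : IsElliptic ρ c C w)
    (u v : Lp ℝ (ENNReal.ofReal p) ρ) :
    |weightedForm w u v| ≤ C * ‖u‖ ^ (p - 1) * ‖v‖ := by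
  have hpq := Real.HolderConjugate.conjExponent hp
  have hu := memLp_signedPow hpq (Lp.memLp u)
  simp only [weightedForm, ← mul_assoc]
  calc |∫ x, w x * signedPow p (u x) * v x ∂ρ|
      ≤ lpNorm (fun x => w x * signedPow p (u x)) (ENNReal.ofReal p.conjExponent) ρ *
          lpNorm v (ENNReal.ofReal p) ρ :=
        abs_integral_mul_le_lpNorm_mul_lpNorm hpq
          (memLp_bdd_mul hw.aestronglyMeasurable hw.abs_le hu) (Lp.memLp v)
    _ ≤ C * lpNorm (fun x => signedPow p (u x)) (ENNReal.ofReal p.conjExponent) ρ *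
          lpNorm v (ENNReal.ofReal p) ρ :=
        mul_le_mul_of_nonneg_right (lpNorm_bdd_mul_le hw.abs_le hu) lpNorm_nonneg
    _ = C * ‖u‖ ^ (p - 1) * ‖v‖ := by
        rw [lpNorm_signedPow hpq (Lp.memLp u), norm_eq_lpNorm, norm_eq_lpNorm]

lemma mul_norm_rpow_le_weightedForm (hp : 0 < p) (hw : IsElliptic ρ c C w)
    (u : Lp ℝ (ENNReal.ofReal p) ρ) : c * ‖u‖ ^ p ≤ weightedForm w u u := by
  have hu := integrable_abs_rpow hp (Lp.memLp u)
  simp only [weightedForm, signedPow_mul_self hp.ne']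
  rw [norm_rpow_eq_integral hp, ← integral_const_mul]
  exact integral_mono (hu.const_mul c) (hw.integrable_mul hu) fun x =>
    mul_le_mul_of_nonneg_right (hw.lower x) (by positivity)

lemma weightedForm_self (hp : 0 < p) (u : Lp ℝ (ENNReal.ofReal p) ρ) :
    weightedForm w u u = p * weightedEnergy w u := by
  simp only [weightedForm, weightedEnergy, signedPow_mul_self hp.ne']
  rw [← integral_const_mul]
  congr 1 with x
  field_simp

lemma weightedEnergy_add_weightedForm_le (hp : 1 < p) (hw : IsElliptic ρ c C w)
    (u v : Lp ℝ (ENNReal.ofReal p) ρ) :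
    weightedEnergy w u + weightedForm w u v ≤ weightedEnergy w (u + v) := by
  have hp0 : 0 < p := by linarith
  have hE (g : Lp ℝ (ENNReal.ofReal p) ρ) :=
    hw.integrable_mul ((integrable_abs_rpow hp0 (Lp.memLp g)).div_const p)
  have hF := hw.integrable_mul (integrable_signedPow_mul hp (Lp.memLp u) (Lp.memLp v))
  rw [weightedEnergy, weightedForm, ← integral_add (hE u) hF]
  refine integral_mono_ae ((hE u).add hF) (hE (u + v)) ?_
  filter_upwards [Lp.coeFn_add u v] with x hx
  have tangent := abs_rpow_tangent_le hp (u x) (u x + v x)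
  rw [add_sub_cancel_left] at tangent
  simp only [hx, Pi.add_apply, ← mul_add]
  exact mul_le_mul_of_nonneg_left tangent (hw.nonneg x)

lemma integral_midpointDefect_eq (hp : 0 < p) (hw : IsElliptic ρ c C w)
    (u v : Lp ℝ (ENNReal.ofReal p) ρ) :
    ∫ x, w x * midpointDefect p (u x) (v x) ∂ρ = p * (weightedEnergy w u + weightedEnergy w v
      - 2 * weightedEnergy w ((1 / 2 : ℝ) • (u + v))) := by
  have hE (g : Lp ℝ (ENNReal.ofReal p) ρ) :=
    hw.integrable_mul ((integrable_abs_rpow hp (Lp.memLp g)).div_const p)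
  simp only [weightedEnergy]
  rw [← integral_add (hE u) (hE v), ← integral_const_mul 2,
    ← integral_sub (by exact (hE u).add (hE v)) ((hE _).const_mul 2), ← integral_const_mul]
  refine integral_congr_ae ?_
  filter_upwards [Lp.coeFn_smul (1 / 2 : ℝ) (u + v), Lp.coeFn_add u v] with x hsmul hadd
  rw [hsmul, Pi.smul_apply, hadd, Pi.add_apply, smul_eq_mul, one_div_mul_eq_div, midpointDefect]
  field_simp

lemma integral_midpointDefect_le (hp : 1 < p) (hw : IsElliptic ρ c C w)
    (u v : Lp ℝ (ENNReal.ofReal p) ρ) :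
    ∫ x, w x * midpointDefect p (u x) (v x) ∂ρ ≤
      p / 2 * (weightedForm w u (u - v) - weightedForm w v (u - v)) := by
  have hF (g h : Lp ℝ (ENNReal.ofReal p) ρ) :=
    hw.integrable_mul (integrable_signedPow_mul hp (Lp.memLp g) (Lp.memLp h))
  rw [weightedForm, weightedForm, ← integral_sub (hF u _) (hF v _), ← integral_const_mul]
  refine integral_mono_ae (hw.integrable_mul (integrable_midpointDefect (by linarith) u v))
    (((hF u _).sub (hF v _)).const_mul _) ?_
  filter_upwards [Lp.coeFn_sub u v] with x hx
  have defect := mul_le_mul_of_nonneg_left (midpointDefect_le hp (u x) (v x)) (hw.nonneg x)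
  simp only [Pi.sub_apply, hx]
  linear_combination defect

lemma exists_norm_sub_rpow_le (ρ : Measure Ω) (hp : 1 < p) (hc : 0 < c) {δ : ℝ} (hδ : 0 < δ) :
    ∃ K, ∀ C w, IsElliptic ρ c C w → ∀ u v : Lp ℝ (ENNReal.ofReal p) ρ, ‖u - v‖ ^ p ≤
      δ * (‖u‖ ^ p + ‖v‖ ^ p) + K * ∫ x, w x * midpointDefect p (u x) (v x) ∂ρ := by
  obtain ⟨K, hK0, hK⟩ := exists_abs_sub_rpow_le_midpointDefect hp hδ
  refine ⟨K / c, fun C w hw u v => ?_⟩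
  have hp0 : 0 < p := by linarith
  have hu := integrable_abs_rpow hp0 (Lp.memLp u)
  have hv := integrable_abs_rpow hp0 (Lp.memLp v)
  have hN := hw.integrable_mul (integrable_midpointDefect hp0 u v)
  rw [norm_rpow_eq_integral hp0, norm_rpow_eq_integral hp0, norm_rpow_eq_integral hp0,
    ← integral_add hu hv, ← integral_const_mul, ← integral_const_mul,
    ← integral_add (by exact (hu.add hv).const_mul δ) (hN.const_mul _)]
  refine integral_mono_ae (integrable_abs_rpow hp0 (Lp.memLp _))
    (((hu.add hv).const_mul δ).add (hN.const_mul _)) ?_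
  filter_upwards [Lp.coeFn_sub u v] with x hx
  have defect : K * midpointDefect p (u x) (v x) ≤
      K / c * (w x * midpointDefect p (u x) (v x)) := by
    rw [div_mul_eq_mul_div, le_div_iff₀ hc, mul_assoc, mul_comm _ c]
    exact mul_le_mul_of_nonneg_left
      (mul_le_mul_of_nonneg_right (hw.lower x) (midpointDefect_nonneg hp _ _)) hK0
  rw [hx]
  exact (hK (u x) (v x)).trans (add_le_add_right defect _)

lemma tendsto_zero_of_forall_le_mul_add {ι : Type*} {l : Filter ι} {a : ι → ℝ} {M : ℝ}
    (ha : ∀ i, 0 ≤ a i)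
    (h : ∀ δ > 0, ∃ b : ι → ℝ, Tendsto b l (𝓝 0) ∧ ∀ᶠ i in l, a i ≤ δ * M + b i) :
    Tendsto a l (𝓝 0) := by
  refine tendsto_order.2 ⟨fun τ hτ => .of_forall fun i => hτ.trans_le (ha i), fun τ hτ => ?_⟩
  obtain ⟨b, hb, hle⟩ := h (τ / (|M| + 1)) (by positivity)
  have hM : τ / (|M| + 1) * M < τ := by
    rw [div_mul_eq_mul_div, div_lt_iff₀ (by positivity)]
    nlinarith [le_abs_self M]
  filter_upwards [hle, hb.eventually (gt_mem_nhds (sub_pos.2 hM))] with i hi hbi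
  linarith

variable {ι : Type*} {l : Filter ι}

lemma tendsto_norm_sub_of_tendsto_midpointDefect (hp : 1 < p) (hc : 0 < c) {w : ι → Ω → ℝ}
    {u v : ι → Lp ℝ (ENNReal.ofReal p) ρ} {M : ℝ} (hw : ∀ᶠ i in l, IsElliptic ρ c C (w i))
    (hu : ∀ᶠ i in l, ‖u i‖ ^ p ≤ M) (hv : ∀ᶠ i in l, ‖v i‖ ^ p ≤ M)
    (h : Tendsto (fun i => ∫ x, w i x * midpointDefect p (u i x) (v i x) ∂ρ) l (𝓝 0)) :
    Tendsto (fun i => ‖u i - v i‖) l (𝓝 0) := by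
  have hp0 : 0 < p := by linarith
  have hpow : Tendsto (fun i => ‖u i - v i‖ ^ p) l (𝓝 0) := by
    refine tendsto_zero_of_forall_le_mul_add (M := M + M)
      (fun i => Real.rpow_nonneg ENNReal.toReal_nonneg p) fun δ hδ => ?_
    obtain ⟨K, hK⟩ := exists_norm_sub_rpow_le ρ hp hc hδ
    refine ⟨_, by simpa using h.const_mul K, ?_⟩
    filter_upwards [hw, hu, hv] with i hw hu hv
    exact (hK C (w i) hw (u i) (v i)).trans
      (add_le_add_left (mul_le_mul_of_nonneg_left (add_le_add hu hv) hδ.le) _)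
  have hroot := hpow.rpow_const (p := p⁻¹) (Or.inr (by positivity))
  rw [Real.zero_rpow (by positivity)] at hroot
  exact hroot.congr fun i => Real.rpow_rpow_inv ENNReal.toReal_nonneg hp0.ne'

/-- The functionals `F i` converge to zero uniformly on the sets where `N` is bounded. -/
def DualTendstoZero {V : Type*} (N : V → ℝ) (l : Filter ι) (F : ι → V → ℝ) : Prop :=
  ∀ τ > 0, ∀ᶠ i in l, ∀ v, |F i v| ≤ τ * N v

lemma DualTendstoZero.add {V : Type*} {N : V → ℝ} {F G : ι → V → ℝ}
    (hF : DualTendstoZero N l F) (hG : DualTendstoZero N l G) :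
    DualTendstoZero N l fun i v => F i v + G i v := fun τ hτ => by
  filter_upwards [hF _ (half_pos hτ), hG _ (half_pos hτ)] with i hFi hGi v
  linarith [abs_add_le (F i v) (G i v), hFi v, hGi v]

variable [Fact (1 ≤ ENNReal.ofReal p)] {V : Type*} [AddCommGroup V] [Module ℝ V]
  {D : V →ₗ[ℝ] Lp ℝ (ENNReal.ofReal p) ρ}

lemma eventually_norm_rpow_le_of_dualTendstoZero (hp : 1 < p) (hc : 0 < c) {w : ι → Ω → ℝ}
    {u : ι → V} {u₀ : V} (hw : ∀ᶠ i in l, IsElliptic ρ c C (w i))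
    (h : DualTendstoZero (fun v => ‖D v‖) l fun i v =>
      weightedForm (w i) (D (u i)) (D v) - weightedForm (w i) (D u₀) (D v)) :
    ∃ M, ∀ᶠ i in l, ‖D (u i)‖ ^ p ≤ M := by
  obtain ⟨K, hK⟩ := exists_mul_le_mul_rpow_add hp (half_pos hc) (C * ‖D u₀‖ ^ (p - 1) + 1)
  refine ⟨K / (c / 2), ?_⟩
  filter_upwards [hw, h 1 one_pos] with i hw hi
  rw [le_div_iff₀ (half_pos hc)]
  have coercive := mul_norm_rpow_le_weightedForm (by linarith) hw (D (u i))
  have bound := abs_weightedForm_le hp hw (D u₀) (D (u i))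
  linarith [le_of_abs_le (hi (u i)), le_of_abs_le bound, hK _ (norm_nonneg (D (u i)))]

theorem tendsto_norm_sub_of_dualTendstoZero (hp : 1 < p) (hc : 0 < c) {w : ι → Ω → ℝ}
    {u : ι → V} {u₀ : V} (hw : ∀ᶠ i in l, IsElliptic ρ c C (w i))
    (h : DualTendstoZero (fun v => ‖D v‖) l fun i v =>
      weightedForm (w i) (D (u i)) (D v) - weightedForm (w i) (D u₀) (D v)) :
    Tendsto (fun i => ‖D (u i) - D u₀‖) l (𝓝 0) := by
  have hp0 : 0 < p := by linarith
  obtain ⟨M, hM⟩ := eventually_norm_rpow_le_of_dualTendstoZero hp hc hw h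
  have hu : ∀ᶠ i in l, ‖D (u i)‖ ^ p ≤ max M (‖D u₀‖ ^ p) :=
    hM.mono fun i hi => hi.trans (le_max_left _ _)
  refine tendsto_norm_sub_of_tendsto_midpointDefect hp hc hw hu
    (.of_forall fun _ => le_max_right _ _) ?_
  set R := max M (‖D u₀‖ ^ p) ^ p⁻¹ + ‖D u₀‖
  have hdiff : ∀ᶠ i in l, ‖D (u i - u₀)‖ ≤ R := hu.mono fun i hi => by
    rw [map_sub]
    exact (norm_sub_le _ _).trans (add_le_add_left ((Real.le_rpow_inv_iff_of_pos (norm_nonneg _)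
      ((Real.rpow_nonneg (norm_nonneg _) p).trans hi) hp0).2 hi) _)
  have hlim : Tendsto (fun i => p / 2 * (weightedForm (w i) (D (u i)) (D (u i - u₀)) -
      weightedForm (w i) (D u₀) (D (u i - u₀)))) l (𝓝 0) := by
    rw [← mul_zero (p / 2)]
    refine Tendsto.const_mul _ (tendsto_zero_iff_abs_tendsto_zero _ |>.2 ?_)
    refine tendsto_zero_of_forall_le_mul_add (M := R) (fun _ => abs_nonneg _)
      fun δ hδ => ⟨0, tendsto_const_nhds, ?_⟩
    filter_upwards [h δ hδ, hdiff] with i hi hdiff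
    simpa using (hi _).trans (mul_le_mul_of_nonneg_left hdiff hδ.le)
  refine squeeze_zero' (hw.mono fun i hw => integral_nonneg fun x =>
    mul_nonneg (hw.nonneg x) (midpointDefect_nonneg hp _ _)) (hw.mono fun i hw => ?_) hlim
  rw [map_sub]
  exact integral_midpointDefect_le hp hw _ _

end WeightedForm

/-! ### Existence and uniqueness -/

section Existence

variable {Ω : Type*} [MeasurableSpace Ω] {ρ : Measure Ω} {p c C K : ℝ} {w : Ω → ℝ}

lemma tendsto_weightedForm_line (hp : 1 < p) (hw : IsElliptic ρ c C w)
    (u v : Lp ℝ (ENNReal.ofReal p) ρ) :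
    Tendsto (fun t : ℝ => weightedForm w (u + t • v) v) (𝓝 0) (𝓝 (weightedForm w u v)) := by
  have hline (t : ℝ) : (fun x => w x * (signedPow p ((u + t • v) x) * v x)) =ᵐ[ρ]
      fun x => w x * (signedPow p (u x + t * v x) * v x) := by
    filter_upwards [Lp.coeFn_add u (t • v), Lp.coeFn_smul t v] with x hadd hsmul
    rw [hadd, Pi.add_apply, hsmul, Pi.smul_apply, smul_eq_mul]
  refine Tendsto.congr (fun t => (integral_congr_ae (hline t)).symm) ?_
  refine tendsto_integral_filter_of_dominated_convergence
    (fun x => C * |signedPow p (|u x| + |v x|) * v x|) (.of_forall fun t => ?_) ?_ ?_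
    (.of_forall fun x => ?_)
  · exact (hw.integrable_mul (integrable_signedPow_mul hp (Lp.memLp _)
      (Lp.memLp v))).aestronglyMeasurable.congr (hline t)
  · filter_upwards [Metric.closedBall_mem_nhds (0 : ℝ) one_pos] with t ht
    rw [mem_closedBall_zero_iff, Real.norm_eq_abs] at ht
    refine .of_forall fun x => ?_
    have hdom : |u x + t * v x| ≤ |(|u x| + |v x|)| := calc
      |u x + t * v x| ≤ |u x| + |t * v x| := abs_add_le _ _
      _ ≤ |u x| + |v x| := by
        rw [abs_mul]
        exact add_le_add_right (mul_le_of_le_one_left (abs_nonneg _) ht) _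
      _ ≤ _ := le_abs_self _
    rw [norm_mul, Real.norm_eq_abs, Real.norm_eq_abs, abs_mul, abs_mul, abs_signedPow hp.ne',
      abs_signedPow hp.ne']
    gcongr
    · exact (abs_nonneg _).trans (hw.abs_le x)
    · exact hw.abs_le x
  · exact (integrable_signedPow_mul hp ((Lp.memLp u).abs.add (Lp.memLp v).abs)
      (Lp.memLp v)).abs.const_mul C
  · have hcont : Continuous fun t : ℝ => w x * (signedPow p (u x + t * v x) * v x) :=
      (((continuous_signedPow hp).comp (by fun_prop)).mul_const (v x)).const_mul (w x)
    simpa only [zero_mul, add_zero] using hcont.tendsto 0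

variable {V : Type*} [AddCommGroup V] [Module ℝ V] {D : V →ₗ[ℝ] Lp ℝ (ENNReal.ofReal p) ρ}
  {ℓ : V →ₗ[ℝ] ℝ}

/-- The convex functional `(1/p) ∫ w |D u|^p - ℓ u`, whose critical points solve
`∫ w |D u|^(p-2) D u D v = ℓ v`. -/
def totalEnergy (D : V →ₗ[ℝ] Lp ℝ (ENNReal.ofReal p) ρ) (w : Ω → ℝ) (ℓ : V →ₗ[ℝ] ℝ) (u : V) : ℝ :=
  weightedEnergy w (D u) - ℓ u

lemma totalEnergy_add_le (hp : 1 < p) (hw : IsElliptic ρ c C w) (u v : V) :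
    totalEnergy D w ℓ u + (weightedForm w (D u) (D v) - ℓ v) ≤ totalEnergy D w ℓ (u + v) := by
  rw [totalEnergy, totalEnergy, map_add, map_add]
  linarith [weightedEnergy_add_weightedForm_le hp hw (D u) (D v)]

lemma integral_midpointDefect_eq_totalEnergy (hp : 0 < p) (hw : IsElliptic ρ c C w) (u v : V) :
    ∫ x, w x * midpointDefect p (D u x) (D v x) ∂ρ = p * (totalEnergy D w ℓ u
      + totalEnergy D w ℓ v - 2 * totalEnergy D w ℓ ((1 / 2 : ℝ) • (u + v))) := by
  simp only [integral_midpointDefect_eq hp hw, totalEnergy, map_smul, map_add, smul_eq_mul]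
  ring

lemma exists_mul_norm_rpow_le_totalEnergy_add (hp : 1 < p) (hw : IsElliptic ρ c C w)
    (hℓ : ∀ v, |ℓ v| ≤ K * ‖D v‖) :
    ∃ K', ∀ u, c / (2 * p) * ‖D u‖ ^ p ≤ totalEnergy D w ℓ u + K' := by
  have hp0 : 0 < p := by linarith
  obtain ⟨K', hK'⟩ := exists_mul_le_mul_rpow_add hp (c := c / (2 * p))
    (div_pos hw.pos (by positivity)) K
  refine ⟨K', fun u => ?_⟩
  have coercive : 2 * (c / (2 * p) * ‖D u‖ ^ p) ≤ weightedEnergy w (D u) := by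
    have h := mul_norm_rpow_le_weightedForm hp0 hw (D u)
    rw [weightedForm_self hp0] at h
    refine le_of_mul_le_mul_left (le_of_eq_of_le ?_ h) hp0
    field_simp
  rw [totalEnergy]
  linarith [le_of_abs_le (hℓ u), hK' ‖D u‖ ENNReal.toReal_nonneg]

lemma weightedForm_eq_of_forall_totalEnergy_le (hp : 1 < p) (hw : IsElliptic ρ c C w) {u : V}
    (hu : ∀ v, totalEnergy D w ℓ u ≤ totalEnergy D w ℓ v) (v : V) :
    weightedForm w (D u) (D v) = ℓ v := by
  have hle (v : V) : ℓ v ≤ weightedForm w (D u) (D v) := by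
    refine ge_of_tendsto ((tendsto_weightedForm_line hp hw (D u) (D v)).mono_left
      nhdsWithin_le_nhds) (eventually_mem_nhdsWithin.mono fun t ht => ?_ :
        ∀ᶠ t in 𝓝[>] (0 : ℝ), _)
    have tangent := totalEnergy_add_le (D := D) (ℓ := ℓ) hp hw (u + t • v) ((-t) • v)
    rw [map_smul, weightedForm_smul_right, map_smul, neg_smul t v, add_neg_cancel_right,
      smul_eq_mul, map_add, map_smul] at tangent
    exact le_of_mul_le_mul_left (by linarith [hu (u + t • v)]) (Set.mem_Ioi.1 ht)
  refine le_antisymm ?_ (hle v)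
  have h := hle ((-1 : ℝ) • v)
  rw [map_smul, map_smul, weightedForm_smul_right, smul_eq_mul] at h
  linarith

variable [Fact (1 ≤ ENNReal.ofReal p)]

lemma cauchySeq_of_tendsto_totalEnergy (hp : 1 < p) (hw : IsElliptic ρ c C w)
    (hℓ : ∀ v, |ℓ v| ≤ K * ‖D v‖) {x : ℕ → V} {I : ℝ} (hI : ∀ v, I ≤ totalEnergy D w ℓ v)
    (hx : Tendsto (fun n => totalEnergy D w ℓ (x n)) atTop (𝓝 I)) :
    CauchySeq fun n => D (x n) := by
  have hp0 : 0 < p := by linarith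
  have hcp : 0 < c / (2 * p) := div_pos hw.pos (by positivity)
  obtain ⟨K', hK'⟩ := exists_mul_norm_rpow_le_totalEnergy_add hp hw hℓ
  have hbound : ∀ᶠ n in atTop, ‖D (x n)‖ ^ p ≤ (I + 1 + K') / (c / (2 * p)) := by
    filter_upwards [hx.eventually (gt_mem_nhds (lt_add_one I))] with n hn
    rw [le_div_iff₀' hcp]
    linarith [hK' (x n)]
  have hfst : Tendsto Prod.fst (atTop : Filter (ℕ × ℕ)) atTop := by
    rw [← prod_atTop_atTop_eq]; exact tendsto_fst
  have hsnd : Tendsto Prod.snd (atTop : Filter (ℕ × ℕ)) atTop := by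
    rw [← prod_atTop_atTop_eq]; exact tendsto_snd
  rw [cauchySeq_iff_tendsto_dist_atTop_0]
  simp only [dist_eq_norm]
  refine tendsto_norm_sub_of_tendsto_midpointDefect hp hw.pos (.of_forall fun _ => hw)
    (hfst.eventually hbound) (hsnd.eventually hbound) ?_
  have hlim : Tendsto (fun n : ℕ × ℕ => p * (totalEnergy D w ℓ (x n.1)
      + totalEnergy D w ℓ (x n.2) - 2 * I)) atTop (𝓝 0) := by
    simpa [two_mul] using
      (((hx.comp hfst).add (hx.comp hsnd)).sub_const (2 * I)).const_mul p
  refine squeeze_zero (fun n => integral_nonneg fun y =>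
    mul_nonneg (hw.nonneg y) (midpointDefect_nonneg hp _ _)) (fun n => ?_) hlim
  rw [integral_midpointDefect_eq_totalEnergy hp0 hw (ℓ := ℓ)]
  gcongr
  exact hI _

lemma exists_forall_totalEnergy_le (hp : 1 < p) (hw : IsElliptic ρ c C w)
    (hD : IsClosed (Set.range D)) (hℓ : ∀ v, |ℓ v| ≤ K * ‖D v‖) :
    ∃ u, ∀ v, totalEnergy D w ℓ u ≤ totalEnergy D w ℓ v := by
  obtain ⟨K', hK'⟩ := exists_mul_norm_rpow_le_totalEnergy_add hp hw hℓ
  have hbdd : BddBelow (Set.range (totalEnergy D w ℓ)) := by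
    refine ⟨-K', Set.forall_mem_range.2 fun u => neg_le_iff_add_nonneg.2 ((hK' u).trans' ?_)⟩
    have := hw.pos
    positivity
  obtain ⟨s, -, hs, hmem⟩ := exists_seq_tendsto_sInf (Set.range_nonempty _) hbdd
  choose x hx using hmem
  obtain rfl : (fun n => totalEnergy D w ℓ (x n)) = s := funext hx
  have hI (v : V) := csInf_le hbdd (Set.mem_range_self v)
  obtain ⟨g, hg⟩ := cauchySeq_tendsto_of_complete (cauchySeq_of_tendsto_totalEnergy hp hw hℓ hI hs)
  obtain ⟨u, rfl⟩ := hD.mem_of_tendsto hg (.of_forall fun n => Set.mem_range_self _)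
  refine ⟨u, fun v => le_trans ?_ (hI v)⟩
  have hdist : Tendsto (fun n => ‖D (x n - u)‖) atTop (𝓝 0) := by
    simpa only [map_sub] using tendsto_iff_norm_sub_tendsto_zero.1 hg
  have hlower : Tendsto (fun n => totalEnergy D w ℓ u
      - (C * ‖D u‖ ^ (p - 1) + K) * ‖D (x n - u)‖) atTop (𝓝 (totalEnergy D w ℓ u)) := by
    simpa using (hdist.const_mul (C * ‖D u‖ ^ (p - 1) + K)).const_sub (totalEnergy D w ℓ u)
  refine le_of_tendsto_of_tendsto' hlower hs fun n => ?_
  have tangent := totalEnergy_add_le (D := D) (ℓ := ℓ) hp hw u (x n - u)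
  rw [add_sub_cancel] at tangent
  linarith [neg_le_of_abs_le (abs_weightedForm_le hp hw (D u) (D (x n - u))),
    le_of_abs_le (hℓ (x n - u))]

theorem existsUnique_weightedForm_eq (hp : 1 < p) (hw : IsElliptic ρ c C w)
    (hinj : Function.Injective D) (hD : IsClosed (Set.range D)) (hℓ : ∀ v, |ℓ v| ≤ K * ‖D v‖) :
    ∃! u, ∀ v, weightedForm w (D u) (D v) = ℓ v := by
  obtain ⟨u, hu⟩ := exists_forall_totalEnergy_le hp hw hD hℓ
  have hsol := weightedForm_eq_of_forall_totalEnergy_le hp hw hu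
  refine ⟨u, hsol, fun u' hu' => hinj (sub_eq_zero.1 (norm_eq_zero.1 ?_))⟩
  refine tendsto_nhds_unique tendsto_const_nhds (tendsto_norm_sub_of_dualTendstoZero (D := D)
    (l := pure ()) (u := fun _ => u') hp hw.pos (.of_forall fun _ => hw) fun τ hτ =>
      .of_forall fun _ v => ?_)
  simp only [hu' v, hsol v, sub_self, abs_zero]
  positivity

end Existence

/-! ### Weak-* limits of oscillating kernels -/

/-- The kernels `b i`, bounded by `C`, converge to zero in the weak-* topology of `L^∞(μ)`. -/
structure TendstoWeakStarZero {ι X : Type*} [MeasurableSpace X] (μ : Measure X) (C : ℝ)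
    (l : Filter ι) (b : ι → X → ℝ) : Prop where
  bound : ∀ i x, |b i x| ≤ C
  aestronglyMeasurable : ∀ᶠ i in l, AEStronglyMeasurable (b i) μ
  tendsto_integral : ∀ g, Integrable g μ → Tendsto (fun i => ∫ x, b i x * g x ∂μ) l (𝓝 0)

lemma TendstoWeakStarZero.of_hasCompactSupport {ι E : Type*} [TopologicalSpace E] [T2Space E]
    [NormalSpace E] [WeaklyLocallyCompactSpace E] [MeasurableSpace E] [BorelSpace E]
    {μ : Measure E} [μ.Regular] {C : ℝ} {l : Filter ι} {b : ι → E → ℝ}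
    (bound : ∀ i x, |b i x| ≤ C) (meas : ∀ᶠ i in l, AEStronglyMeasurable (b i) μ)
    (h : ∀ g, Continuous g → HasCompactSupport g →
      Tendsto (fun i => ∫ x, b i x * g x ∂μ) l (𝓝 0)) : TendstoWeakStarZero μ C l b := by
  refine ⟨bound, meas, fun g hg => ?_⟩
  rcases isEmpty_or_nonempty E with hE | ⟨⟨x₀⟩⟩
  · simpa [Measure.eq_zero_of_isEmpty] using tendsto_const_nhds
  rw [tendsto_zero_iff_abs_tendsto_zero]
  refine tendsto_zero_of_forall_le_mul_add (M := C) (fun _ => abs_nonneg _) fun δ hδ => ?_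
  obtain ⟨h₀, hsupp, hclose, hcont, hint⟩ := hg.exists_hasCompactSupport_integral_sub_le hδ
  refine ⟨_, (tendsto_zero_iff_abs_tendsto_zero _).1 (h h₀ hcont hsupp), ?_⟩
  filter_upwards [meas] with i hi
  have hC : 0 ≤ C := (abs_nonneg _).trans (bound i x₀)
  have hmul {k : E → ℝ} (hk : Integrable k μ) : Integrable (fun x => b i x * k x) μ :=
    hk.bdd_mul hi (.of_forall (bound i))
  have split : ∫ x, b i x * g x ∂μ = (∫ x, b i x * (g x - h₀ x) ∂μ) + ∫ x, b i x * h₀ x ∂μ := by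
    rw [← integral_add (by exact hmul (hg.sub hint)) (hmul hint)]
    simp only [mul_sub, sub_add_cancel]
  have error : |∫ x, b i x * (g x - h₀ x) ∂μ| ≤ δ * C := calc
    |∫ x, b i x * (g x - h₀ x) ∂μ| ≤ ∫ x, |b i x * (g x - h₀ x)| ∂μ := abs_integral_le_integral_abs
    _ ≤ ∫ x, C * ‖g x - h₀ x‖ ∂μ := by
      refine integral_mono (hmul (hg.sub hint)).abs ((hg.sub hint).norm.const_mul C) fun x => ?_
      rw [abs_mul]
      exact mul_le_mul_of_nonneg_right (bound i x) (abs_nonneg _)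
    _ ≤ δ * C := by
      rw [integral_const_mul, mul_comm]
      exact mul_le_mul_of_nonneg_right hclose hC
  rw [Function.comp_apply, split]
  exact (abs_add_le _ _).trans (add_le_add_left error _)

section Oscillation

variable {E : Type*} [NormedAddCommGroup E] [NormedSpace ℝ E] {ι : Type*}
  {b : Module.Basis ι ℝ E}

lemma periodic_of_mem_span {f : E → ℝ} (hf : ∀ i, Function.Periodic f (b i)) {v : E}
    (hv : v ∈ Submodule.span ℤ (Set.range b)) : Function.Periodic f v := by
  induction hv using Submodule.span_induction with
  | mem v hv => obtain ⟨i, rfl⟩ := hv; exact hf i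
  | zero => exact fun x => by rw [add_zero]
  | add v w _ _ hv hw => exact hv.add_period hw
  | smul n v _ hv => exact hv.zsmul n

/-- The representative of the class of `ε ζ` modulo `ε` times the lattice lying in the cell whose
lowest corner is `z`. -/
def cellPoint [Fintype ι] (b : Module.Basis ι ℝ E) (ε : ℝ) (z ζ : E) : E :=
  z + ε • ZSpan.fract b (ζ - ε⁻¹ • z)

lemma cellPoint_zero [Fintype ι] (z ζ : E) : cellPoint b 0 z ζ = z := by
  rw [cellPoint, zero_smul, add_zero]

lemma norm_cellPoint_sub_le [Fintype ι] (ε : ℝ) (z ζ : E) :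
    ‖cellPoint b ε z ζ - z‖ ≤ |ε| * ∑ i, ‖b i‖ := by
  rw [cellPoint, add_sub_cancel_left, norm_smul, Real.norm_eq_abs]
  exact mul_le_mul_of_nonneg_left (ZSpan.norm_fract_le b _) (abs_nonneg _)

lemma tendsto_cellPoint [Fintype ι] (z ζ : E) :
    Tendsto (fun ε => cellPoint b ε z ζ) (𝓝 0) (𝓝 z) := by
  rw [tendsto_iff_norm_sub_tendsto_zero]
  have hlim : Tendsto (fun ε : ℝ => |ε| * ∑ i, ‖b i‖) (𝓝 0) (𝓝 0) := by
    simpa using (continuous_abs.tendsto (0 : ℝ)).mul_const (∑ i, ‖b i‖)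
  exact squeeze_zero (fun _ => norm_nonneg _) (fun ε => norm_cellPoint_sub_le ε z ζ) hlim

variable [MeasurableSpace E] {μ : Measure E} {C : ℝ} {A : E → E → ℝ}

/-- A function `A z ζ` of a slow variable `z` and a fast variable `ζ`: continuous in `z`,
measurable in `ζ`, periodic in `ζ` along the lattice spanned by `b`, and bounded by `C`. -/
structure IsOscillating (μ : Measure E) (b : Module.Basis ι ℝ E) (C : ℝ) (A : E → E → ℝ) :
    Prop where
  continuous : ∀ ζ, Continuous fun z => A z ζ
  aemeasurable : ∀ z, AEMeasurable (A z) μ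
  periodic : ∀ z i, Function.Periodic (A z) (b i)
  bound : ∀ z ζ, |A z ζ| ≤ C

lemma IsOscillating.mul_continuous (hA : IsOscillating μ b C A) {g : E → ℝ} (hg : Continuous g)
    {G : ℝ} (hG : ∀ z, |g z| ≤ G) : IsOscillating μ b (C * G) fun z ζ => A z ζ * g z where
  continuous ζ := (hA.continuous ζ).mul hg
  aemeasurable z := (hA.aemeasurable z).mul_const _
  periodic z i ζ := by simp only [hA.periodic z i ζ]
  bound z ζ := by
    rw [abs_mul]
    exact mul_le_mul (hA.bound z ζ) (hG z) (abs_nonneg _) ((abs_nonneg _).trans (hA.bound z ζ))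

lemma IsOscillating.abs_mean_le [IsProbabilityMeasure (μ.restrict (ZSpan.fundamentalDomain b))]
    (hA : IsOscillating μ b C A) (z : E) :
    |∫ ζ in ZSpan.fundamentalDomain b, A z ζ ∂μ| ≤ C := by
  simpa using norm_integral_le_of_norm_le_const
    (μ := μ.restrict (ZSpan.fundamentalDomain b)) (f := A z)
    (.of_forall fun ζ => hA.bound z ζ)

lemma IsOscillating.norm_cellPoint_le_indicator [Fintype ι] (hA : IsOscillating μ b C A) {R : ℝ}
    (hR : ∀ z ζ, R < ‖z‖ → A z ζ = 0) {ε : ℝ} (hε : |ε| ≤ 1) (z ζ : E) :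
    ‖A (cellPoint b ε z ζ) ζ‖ ≤
      (Metric.closedBall 0 (R + ∑ i, ‖b i‖)).indicator (fun _ => C) z := by
  by_cases hz : z ∈ Metric.closedBall 0 (R + ∑ i, ‖b i‖)
  · rw [Set.indicator_of_mem hz]
    exact hA.bound _ _
  rw [Set.indicator_of_notMem hz, hR, norm_zero]
  rw [mem_closedBall_zero_iff, not_le] at hz
  have hr : |ε| * ∑ i, ‖b i‖ ≤ ∑ i, ‖b i‖ := mul_le_of_le_one_left (by positivity) hε
  have hdist := norm_cellPoint_sub_le (b := b) ε z ζ
  rw [norm_sub_rev] at hdist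
  linarith [norm_sub_norm_le z (cellPoint b ε z ζ)]

variable [BorelSpace E] [FiniteDimensional ℝ E]

/-- `A` itself need not be jointly measurable, since each `A z` is only almost everywhere equal to a
measurable function. -/
lemma exists_measurable_ae_forall_eq (hcont : ∀ ζ, Continuous fun z => A z ζ)
    (hmeas : ∀ z, AEMeasurable (A z) μ) :
    ∃ B : E → E → ℝ, Measurable (Function.uncurry B) ∧ ∀ᵐ ζ ∂μ, ∀ z, A z ζ = B z ζ := by
  let q := TopologicalSpace.denseSeq E
  let T := toMeasurable μ (⋃ n, {ζ | A (q n) ζ ≠ (hmeas (q n)).mk _ ζ})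
  have hT : μ T = 0 := by
    rw [measure_toMeasurable]
    exact measure_iUnion_null fun n => (hmeas (q n)).ae_eq_mk
  let B : E → E → ℝ := fun z => Tᶜ.indicator (A z)
  have hBcont (ζ : E) : Continuous fun z => B z ζ := by
    by_cases hζ : ζ ∈ Tᶜ
    · simpa only [B, Set.indicator_of_mem hζ] using hcont ζ
    · simpa only [B, Set.indicator_of_notMem hζ] using continuous_const
  have hBdense (n : ℕ) : Measurable (B (q n)) := by
    have hmk : B (q n) = Tᶜ.indicator ((hmeas (q n)).mk _) :=
      Set.indicator_congr fun ζ hζ => not_not.1 fun hne =>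
        hζ (subset_toMeasurable μ _ (Set.mem_iUnion.2 ⟨n, hne⟩))
    rw [hmk]
    exact (hmeas (q n)).measurable_mk.indicator (measurableSet_toMeasurable _ _).compl
  have hB (z : E) : Measurable (B z) := by
    obtain ⟨s, hs, hlim⟩ := mem_closure_iff_seq_limit.1 (TopologicalSpace.denseRange_denseSeq E z)
    refine measurable_of_tendsto_metrizable (f := fun n => B (s n)) (fun n => ?_)
      (tendsto_pi_nhds.2 fun ζ => ((hBcont ζ).tendsto z).comp hlim)
    obtain ⟨k, hk⟩ := hs n
    exact hk ▸ hBdense k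
  refine ⟨B, (stronglyMeasurable_uncurry_of_continuous_of_stronglyMeasurable hBcont
    fun z => (hB z).stronglyMeasurable).measurable, ?_⟩
  filter_upwards [measure_eq_zero_iff_ae_notMem.1 hT] with ζ hζ z
  exact (Set.indicator_of_mem (Set.mem_compl hζ) _).symm

lemma measurable_zspan_fract [Fintype ι] : Measurable (ZSpan.fract b) := by
  classical
  have hsum : ZSpan.fract b = fun x => ∑ i, Int.fract (b.repr x i) • b i := funext fun x =>
    b.ext_elem fun i => by rw [ZSpan.repr_fract_apply, b.repr_sum_self]
  rw [hsum]
  exact Finset.measurable_sum _ fun i _ => (measurable_fract.comp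
    (b.coord i).continuous_of_finiteDimensional.measurable).smul_const (b i)

lemma measurable_cellPoint [Fintype ι] (ε : ℝ) :
    Measurable fun x : E × E => cellPoint b ε x.1 x.2 :=
  measurable_fst.add ((measurable_zspan_fract.comp (by fun_prop)).const_smul ε)

lemma IsOscillating.aestronglyMeasurable_cellPoint [Fintype ι] [SFinite μ]
    (hA : IsOscillating μ b C A) (ε : ℝ) :
    AEStronglyMeasurable (fun x : E × E => A (cellPoint b ε x.1 x.2) x.2)
      (μ.prod (μ.restrict (ZSpan.fundamentalDomain b))) := by
  obtain ⟨B, hB, hAB⟩ := exists_measurable_ae_forall_eq hA.continuous hA.aemeasurable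
  have hcell := hB.comp ((measurable_cellPoint (b := b) ε).prodMk measurable_snd)
  refine hcell.aestronglyMeasurable.congr ?_
  filter_upwards [Measure.quasiMeasurePreserving_snd.ae (ae_restrict_of_ae hAB)] with x hx
  exact (hx _).symm

variable [μ.IsAddHaarMeasure]

lemma setIntegral_fundamentalDomain_add [Finite ι] {P : E → ℝ}
    (hP : ∀ i, Function.Periodic P (b i)) (s : E) :
    ∫ y in ZSpan.fundamentalDomain b, P (s + y) ∂μ = ∫ y in ZSpan.fundamentalDomain b, P y ∂μ := by
  have : VAddInvariantMeasure (Submodule.span ℤ (Set.range b)) E μ :=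
    ⟨fun c s _ => measure_preimage_add μ (c : E) s⟩
  have hY := ZSpan.isAddFundamentalDomain b μ
  rw [← (hY.vadd_of_comm s).setIntegral_eq hY (f := P) fun g x => by
    rw [Submodule.vadd_def, vadd_eq_add, add_comm, periodic_of_mem_span hP g.2]]
  exact ((measurePreserving_add_left μ s).setIntegral_image_emb
    (measurableEmbedding_addLeft s) P _).symm

lemma integral_integral_add_smul {ν : Measure E} [IsProbabilityMeasure ν] {f : E → ℝ}
    (hf : Integrable f μ) (ε : ℝ) : ∫ z, ∫ y, f (z + ε • y) ∂ν ∂μ = ∫ z, f z ∂μ := by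
  have shear : MeasurePreserving (fun x : E × E => (x.1, x.2 + ε • x.1)) (ν.prod μ) (ν.prod μ) :=
    (MeasurePreserving.id ν).skew_product (by fun_prop)
      (.of_forall fun y => (measurePreserving_add_right μ (ε • y)).map_eq)
  have hint : Integrable (fun x : E × E => f (x.2 + ε • x.1)) (ν.prod μ) :=
    shear.integrable_comp_of_integrable (hf.comp_snd ν)
  rw [← integral_integral_swap hint]
  simp only [integral_add_right_eq_self f, integral_const, probReal_univ, one_smul]

namespace IsOscillating

lemma aestronglyMeasurable_diag (hA : IsOscillating μ b C A) {ε : ℝ} (hε : ε ≠ 0) :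
    AEStronglyMeasurable (fun z => A z (ε⁻¹ • z)) μ := by
  obtain ⟨B, hB, hAB⟩ := exists_measurable_ae_forall_eq hA.continuous hA.aemeasurable
  have hBdiag : Measurable fun z => B z (ε⁻¹ • z) :=
    hB.comp (measurable_id.prodMk (measurable_const_smul _))
  refine hBdiag.aestronglyMeasurable.congr ?_
  filter_upwards [(Measure.quasiMeasurePreserving_smul μ (inv_ne_zero hε)).ae hAB] with z hz
  exact (hz z).symm

lemma aestronglyMeasurable_mean (hA : IsOscillating μ b C A) (Y : Set E) :
    AEStronglyMeasurable (fun z => ∫ ζ in Y, A z ζ ∂μ) μ := by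
  obtain ⟨B, hB, hAB⟩ := exists_measurable_ae_forall_eq hA.continuous hA.aemeasurable
  have hmean : (fun z => ∫ ζ in Y, A z ζ ∂μ) = fun z => ∫ ζ in Y, B z ζ ∂μ := funext fun z =>
    integral_congr_ae (ae_restrict_of_ae (hAB.mono fun ζ hζ => hζ z))
  rw [hmean]
  exact (hB.stronglyMeasurable.integral_prod_right (ν := μ.restrict Y)).aestronglyMeasurable

variable [IsProbabilityMeasure (μ.restrict (ZSpan.fundamentalDomain b))]

/-- Averaging `z ↦ A z (z/ε)` over the translates of a cell and using periodicity decouples the two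
variables. -/
lemma integral_diag_eq [Fintype ι] (hA : IsOscillating μ b C A) {ε : ℝ} (hε : ε ≠ 0)
    (hint : Integrable (fun z => A z (ε⁻¹ • z)) μ) :
    ∫ z, A z (ε⁻¹ • z) ∂μ =
      ∫ z, ∫ ζ in ZSpan.fundamentalDomain b, A (cellPoint b ε z ζ) ζ ∂μ ∂μ := by
  rw [← integral_integral_add_smul (ν := μ.restrict (ZSpan.fundamentalDomain b)) hint ε]
  congr 1 with z
  have hP (i : ι) : Function.Periodic (fun ζ => A (cellPoint b ε z ζ) ζ) (b i) := fun ζ => by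
    simp only [hA.periodic _ i ζ]
    rw [cellPoint, add_sub_right_comm,
      ZSpan.fract_add_ZSpan b _ (Submodule.subset_span ⟨i, rfl⟩), cellPoint]
  rw [← setIntegral_fundamentalDomain_add hP (ε⁻¹ • z)]
  refine setIntegral_congr_fun (ZSpan.fundamentalDomain_measurableSet b) fun y hy => ?_
  rw [cellPoint, add_sub_cancel_left, ZSpan.fract_eq_self.2 hy, smul_add, inv_smul_smul₀ hε]

lemma tendsto_integral_diag [Finite ι] (hA : IsOscillating μ b C A) {R : ℝ}
    (hR : ∀ z ζ, R < ‖z‖ → A z ζ = 0) :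
    Tendsto (fun ε : ℝ => ∫ z, A z (ε⁻¹ • z) ∂μ) (𝓝[>] 0)
      (𝓝 (∫ z, ∫ ζ in ZSpan.fundamentalDomain b, A z ζ ∂μ ∂μ)) := by
  cases nonempty_fintype ι
  let π := μ.prod (μ.restrict (ZSpan.fundamentalDomain b))
  let S : Set E := Metric.closedBall 0 (R + ∑ i, ‖b i‖)
  have hdom : Integrable (fun x : E × E => S.indicator (fun _ => C) x.1) π :=
    ((integrable_indicator_iff measurableSet_closedBall).2
      (integrableOn_const measure_closedBall_lt_top.ne)).comp_fst _
  have hbound {ε : ℝ} (hε : |ε| ≤ 1) (x : E × E) :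
      ‖A (cellPoint b ε x.1 x.2) x.2‖ ≤ S.indicator (fun _ => C) x.1 :=
    hA.norm_cellPoint_le_indicator hR hε x.1 x.2
  have hint {ε : ℝ} (hε : |ε| ≤ 1) : Integrable (fun x => A (cellPoint b ε x.1 x.2) x.2) π :=
    hdom.mono' (hA.aestronglyMeasurable_cellPoint ε) (.of_forall (hbound hε))
  have hsmall : ∀ᶠ ε : ℝ in 𝓝 0, |ε| ≤ 1 := by
    filter_upwards [Metric.closedBall_mem_nhds (0 : ℝ) one_pos] with ε hε
    simpa using hε
  have hdiag {ε : ℝ} (hε : ε ≠ 0) : Integrable (fun z => A z (ε⁻¹ • z)) μ :=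
    (integrableOn_iff_integrable_of_support_subset (s := Metric.closedBall 0 R) fun z hz =>
      mem_closedBall_zero_iff.2 (not_lt.1 fun h => hz (hR z _ h))).1
      (Measure.integrableOn_of_bounded measure_closedBall_lt_top.ne
        (hA.aestronglyMeasurable_diag hε) (.of_forall fun z => hA.bound _ _))
  have hlim : Tendsto (fun ε => ∫ x, A (cellPoint b ε x.1 x.2) x.2 ∂π) (𝓝 0)
      (𝓝 (∫ x, A (cellPoint b 0 x.1 x.2) x.2 ∂π)) := by
    refine tendsto_integral_filter_of_dominated_convergence _
      (.of_forall hA.aestronglyMeasurable_cellPoint)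
      (hsmall.mono fun ε hε => .of_forall (hbound hε)) hdom (.of_forall fun x => ?_)
    rw [cellPoint_zero]
    exact ((hA.continuous x.2).tendsto _).comp (tendsto_cellPoint x.1 x.2)
  rw [integral_prod _ (hint (by simp))] at hlim
  simp only [cellPoint_zero] at hlim
  refine (hlim.mono_left nhdsWithin_le_nhds).congr' ?_
  filter_upwards [eventually_mem_nhdsWithin, hsmall.filter_mono nhdsWithin_le_nhds] with ε hε hε1
  have hε : ε ≠ 0 := (Set.mem_Ioi.1 hε).ne'
  rw [hA.integral_diag_eq hε (hdiag hε), integral_prod _ (hint hε1)]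

theorem tendstoWeakStarZero [Finite ι] (hA : IsOscillating μ b C A) :
    TendstoWeakStarZero μ (C + C) (𝓝[>] 0) fun (ε : ℝ) z =>
      A z (ε⁻¹ • z) - ∫ ζ in ZSpan.fundamentalDomain b, A z ζ ∂μ := by
  have hmean := hA.aestronglyMeasurable_mean (ZSpan.fundamentalDomain b)
  refine .of_hasCompactSupport
    (fun ε z => (abs_sub _ _).trans (add_le_add (hA.bound _ _) (hA.abs_mean_le z))) ?_
    fun g hg hgs => ?_
  · filter_upwards [eventually_mem_nhdsWithin] with ε hε
    exact (hA.aestronglyMeasurable_diag (Set.mem_Ioi.1 hε).ne').sub hmean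
  obtain ⟨G, hG⟩ := hgs.exists_bound_of_continuous hg
  obtain ⟨R, hR⟩ := hgs.isCompact.isBounded.subset_closedBall (0 : E)
  have hlim := (hA.mul_continuous hg hG).tendsto_integral_diag (R := R) fun z ζ hz => by
    rw [image_eq_zero_of_notMem_tsupport fun h => hz.not_ge (mem_closedBall_zero_iff.1 (hR h)),
      mul_zero]
  simp only [integral_mul_const] at hlim
  have hgint : Integrable g μ := hg.integrable_of_hasCompactSupport hgs
  refine (tendsto_sub_nhds_zero_iff.2 hlim).congr' ?_
  filter_upwards [eventually_mem_nhdsWithin] with ε hε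
  rw [← integral_sub
    (hgint.bdd_mul (hA.aestronglyMeasurable_diag (Set.mem_Ioi.1 hε).ne')
      (.of_forall fun z => hA.bound _ _))
    (hgint.bdd_mul hmean (.of_forall hA.abs_mean_le))]
  simp only [sub_mul]

end IsOscillating

end Oscillation

/-! ### Measures on a disjoint union -/

section SumMeasure

variable {X Y : Type*} [MeasurableSpace X] [MeasurableSpace Y] {μ : Measure X} {ν : Measure Y}

lemma measurableEmbedding_inl : MeasurableEmbedding (Sum.inl : X → X ⊕ Y) :=
  ⟨Sum.inl_injective, measurable_inl, fun _ hs => measurableSet_inl_image.2 hs⟩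

lemma measurableEmbedding_inr : MeasurableEmbedding (Sum.inr : Y → X ⊕ Y) :=
  ⟨Sum.inr_injective, measurable_inr, fun _ hs => measurableSet_inr_image.2 hs⟩

/-- The measure on `X ⊕ Y` restricting to `μ` on `X` and to `ν` on `Y`. -/
def sumMeasure (μ : Measure X) (ν : Measure Y) : Measure (X ⊕ Y) :=
  μ.map Sum.inl + ν.map Sum.inr

lemma ae_sumMeasure_iff {P : X ⊕ Y → Prop} :
    (∀ᵐ s ∂sumMeasure μ ν, P s) ↔ (∀ᵐ x ∂μ, P (.inl x)) ∧ ∀ᵐ y ∂ν, P (.inr y) := by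
  rw [sumMeasure, ae_add_measure_iff, measurableEmbedding_inl.ae_map_iff,
    measurableEmbedding_inr.ae_map_iff]

lemma aestronglyMeasurable_sumMeasure_iff {F : X ⊕ Y → ℝ} :
    AEStronglyMeasurable F (sumMeasure μ ν) ↔
      AEStronglyMeasurable (F ∘ Sum.inl) μ ∧ AEStronglyMeasurable (F ∘ Sum.inr) ν := by
  rw [sumMeasure, aestronglyMeasurable_add_measure_iff,
    measurableEmbedding_inl.aestronglyMeasurable_map_iff,
    measurableEmbedding_inr.aestronglyMeasurable_map_iff]

lemma integrable_sumMeasure_iff {F : X ⊕ Y → ℝ} :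
    Integrable F (sumMeasure μ ν) ↔ Integrable (F ∘ Sum.inl) μ ∧ Integrable (F ∘ Sum.inr) ν := by
  rw [sumMeasure, integrable_add_measure, measurableEmbedding_inl.integrable_map_iff,
    measurableEmbedding_inr.integrable_map_iff]

lemma integral_sumMeasure {F : X ⊕ Y → ℝ} (hF : Integrable F (sumMeasure μ ν)) :
    ∫ s, F s ∂sumMeasure μ ν = ∫ x, F (.inl x) ∂μ + ∫ y, F (.inr y) ∂ν := by
  obtain ⟨hl, hr⟩ := integrable_add_measure.1 hF
  rw [sumMeasure, integral_add_measure hl hr, measurableEmbedding_inl.integral_map,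
    measurableEmbedding_inr.integral_map]

lemma memLp_sumMeasure_iff {p : ℝ} (hp : 0 < p) {F : X ⊕ Y → ℝ} :
    MemLp F (ENNReal.ofReal p) (sumMeasure μ ν) ↔
      MemLp (F ∘ Sum.inl) (ENNReal.ofReal p) μ ∧ MemLp (F ∘ Sum.inr) (ENNReal.ofReal p) ν := by
  by_cases hF : AEStronglyMeasurable F (sumMeasure μ ν)
  · obtain ⟨hl, hr⟩ := aestronglyMeasurable_sumMeasure_iff.1 hF
    rw [memLp_iff_integrable_abs_rpow hp hF, memLp_iff_integrable_abs_rpow hp hl,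
      memLp_iff_integrable_abs_rpow hp hr, integrable_sumMeasure_iff]
    rfl
  · exact ⟨fun h => absurd h.1 hF,
      fun h => absurd (aestronglyMeasurable_sumMeasure_iff.2 ⟨h.1.1, h.2.1⟩) hF⟩

end SumMeasure

/-! ### The fractional Sobolev space as a closed subspace of an `L^p` space -/

section SobolevSpace

variable {d : ℕ} {α p : ℝ}

/-- The density `|x - y|^(-d-α)`. -/
def singularKernel (α : ℝ) (z : Rd d × Rd d) : NNReal :=
  Real.toNNReal (‖z.1 - z.2‖ ^ ((d : ℝ) + α))⁻¹

lemma measurable_singularKernel (α : ℝ) : Measurable (singularKernel (d := d) α) := by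
  unfold singularKernel; fun_prop

/-- The measure `|x - y|^(-d-α) dx dy`, with respect to which the Gagliardo energy is the `p`-th
power of the `L^p` norm of the increments. -/
def gagliardoMeasure (d : ℕ) (α : ℝ) : Measure (Rd d × Rd d) :=
  volume.withDensity fun z => (singularKernel α z : ENNReal)

lemma gagliardoMeasure_absolutelyContinuous : gagliardoMeasure d α ≪ volume :=
  withDensity_absolutelyContinuous _ _

lemma integrable_gagliardoMeasure_iff {g : Rd d × Rd d → ℝ} :
    Integrable g (gagliardoMeasure d α) ↔
      Integrable fun z => (‖z.1 - z.2‖ ^ ((d : ℝ) + α))⁻¹ * g z := by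
  rw [gagliardoMeasure, integrable_withDensity_iff_integrable_smul (measurable_singularKernel α)]
  refine integrable_congr (.of_forall fun z => ?_)
  simp only [NNReal.smul_def, smul_eq_mul, singularKernel]
  rw [Real.coe_toNNReal _ (by positivity)]

lemma integral_gagliardoMeasure (g : Rd d × Rd d → ℝ) :
    ∫ z, g z ∂gagliardoMeasure d α = ∫ z, (‖z.1 - z.2‖ ^ ((d : ℝ) + α))⁻¹ * g z := by
  rw [gagliardoMeasure, integral_withDensity_eq_integral_smul (measurable_singularKernel α)]
  refine integral_congr_ae (.of_forall fun z => ?_)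
  simp only [NNReal.smul_def, smul_eq_mul, singularKernel]
  rw [Real.coe_toNNReal _ (by positivity)]

/-- The increments `(x, y) ↦ u y - u x` of a function. -/
def increment (u : Rd d → ℝ) (z : Rd d × Rd d) : ℝ := u z.2 - u z.1

lemma increment_ae_eq {u v : Rd d → ℝ} (h : u =ᵐ[volume] v) :
    increment u =ᵐ[gagliardoMeasure d α] increment v := by
  refine gagliardoMeasure_absolutelyContinuous.ae_le ?_
  filter_upwards [Measure.quasiMeasurePreserving_fst.ae h, Measure.quasiMeasurePreserving_snd.ae h]
    with z h1 h2
  rw [increment, h1, h2, increment]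

lemma aestronglyMeasurable_increment {u : Rd d → ℝ} (hu : AEStronglyMeasurable u volume) :
    AEStronglyMeasurable (increment u) (gagliardoMeasure d α) :=
  ((hu.comp_quasiMeasurePreserving Measure.quasiMeasurePreserving_snd).sub
    (hu.comp_quasiMeasurePreserving Measure.quasiMeasurePreserving_fst)).mono_ac
      gagliardoMeasure_absolutelyContinuous

lemma gagliardoEnergy_eq_lintegral (u : Rd d → ℝ) : gagliardoEnergy α p u =
    ∫⁻ z, ENNReal.ofReal (|increment u z| ^ p) ∂gagliardoMeasure d α := by
  rw [gagliardoMeasure, lintegral_withDensity_eq_lintegral_mul_non_measurable _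
    (measurable_singularKernel α).coe_nnreal_ennreal (.of_forall fun z => ENNReal.coe_lt_top)]
  refine lintegral_congr fun z => ?_
  rw [Pi.mul_apply, singularKernel, ← ENNReal.ofReal, ← ENNReal.ofReal_mul (by positivity),
    div_eq_inv_mul, increment]

lemma memLp_increment_iff (hp : 0 < p) {u : Rd d → ℝ} (hu : AEStronglyMeasurable u volume) :
    MemLp (increment u) (ENNReal.ofReal p) (gagliardoMeasure d α) ↔
      gagliardoEnergy α p u < ⊤ := by
  have hm := aestronglyMeasurable_increment (α := α) hu
  rw [memLp_iff_integrable_abs_rpow hp hm, gagliardoEnergy_eq_lintegral, lt_top_iff_ne_top,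
    lintegral_ofReal_ne_top_iff_integrable
      ((continuous_abs_rpow hp.le).comp_aestronglyMeasurable hm)
      (.of_forall fun z => by positivity)]

lemma integral_abs_increment_rpow (hp : 0 < p) {u : Rd d → ℝ}
    (hu : AEStronglyMeasurable u volume) :
    ∫ z, |increment u z| ^ p ∂gagliardoMeasure d α = (gagliardoEnergy α p u).toReal := by
  rw [gagliardoEnergy_eq_lintegral,
    integral_eq_lintegral_of_nonneg_ae (.of_forall fun z => by positivity)]
  exact (continuous_abs_rpow hp.le).comp_aestronglyMeasurable (aestronglyMeasurable_increment hu)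

/-- Lebesgue measure and `|x - y|^(-d-α) dx dy` on the disjoint union `ℝ^d ⊕ ℝ^d × ℝ^d`. -/
abbrev sobolevMeasure (d : ℕ) (α : ℝ) : Measure (Rd d ⊕ (Rd d × Rd d)) :=
  sumMeasure volume (gagliardoMeasure d α)

/-- A function on `ℝ^d` together with its increments on `ℝ^d × ℝ^d`. -/
def withIncrement (u : Rd d → ℝ) : Rd d ⊕ (Rd d × Rd d) → ℝ := Sum.elim u (increment u)

lemma withIncrement_ae_eq {u v : Rd d → ℝ} (h : u =ᵐ[volume] v) :
    withIncrement u =ᵐ[sobolevMeasure d α] withIncrement v :=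
  ae_sumMeasure_iff.2 ⟨h, increment_ae_eq h⟩

variable {hp : 1 < p}

lemma memLp_increment (u : Sobolev d α p hp) :
    MemLp (increment u.1) (ENNReal.ofReal p) (gagliardoMeasure d α) :=
  (memLp_increment_iff (by linarith) (Lp.aestronglyMeasurable u.1)).2 u.2

lemma memLp_withIncrement (u : Sobolev d α p hp) :
    MemLp (withIncrement u.1) (ENNReal.ofReal p) (sobolevMeasure d α) :=
  (memLp_sumMeasure_iff (by linarith)).2 ⟨Lp.memLp u.1, memLp_increment u⟩

/-- The embedding `u ↦ (u, (x, y) ↦ u y - u x)` of the Sobolev space into an `L^p` space. -/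
def sobolevEmbedding (d : ℕ) (α p : ℝ) (hp : 1 < p) :
    Sobolev d α p hp →ₗ[ℝ] Lp ℝ (ENNReal.ofReal p) (sobolevMeasure d α) where
  toFun u := (memLp_withIncrement u).toLp
  map_add' u v := by
    rw [← MemLp.toLp_add]
    refine MemLp.toLp_congr _ _ ((withIncrement_ae_eq (Lp.coeFn_add u.1 v.1)).trans
      (.of_forall ?_))
    rintro (x | z)
    · rfl
    · exact add_sub_add_comm _ _ _ _
  map_smul' c u := by
    rw [RingHom.id_apply, ← MemLp.toLp_const_smul]
    refine MemLp.toLp_congr _ _ ((withIncrement_ae_eq (Lp.coeFn_smul c u.1)).trans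
      (.of_forall ?_))
    rintro (x | z)
    · rfl
    · exact (mul_sub c _ _).symm

lemma coeFn_sobolevEmbedding (u : Sobolev d α p hp) :
    sobolevEmbedding d α p hp u =ᵐ[sobolevMeasure d α] withIncrement u.1 :=
  (memLp_withIncrement u).coeFn_toLp

lemma norm_sobolevEmbedding_rpow (u : Sobolev d α p hp) :
    ‖sobolevEmbedding d α p hp u‖ ^ p =
      (∫ x, |u.1 x| ^ p) + ∫ z, |increment u.1 z| ^ p ∂gagliardoMeasure d α := by
  have hp0 : 0 < p := by linarith
  rw [norm_rpow_eq_integral hp0]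
  refine Eq.trans (integral_congr_ae ?_)
    (integral_sumMeasure (integrable_abs_rpow hp0 (memLp_withIncrement u)))
  filter_upwards [coeFn_sobolevEmbedding u] with x hx
  rw [hx]

lemma norm_sobolevEmbedding (u : Sobolev d α p hp) :
    ‖sobolevEmbedding d α p hp u‖ = sobolevNorm u := by
  have hp0 : 0 < p := by linarith
  rw [sobolevNorm, norm_rpow_eq_integral hp0,
    ← integral_abs_increment_rpow hp0 (Lp.aestronglyMeasurable u.1), ← norm_sobolevEmbedding_rpow,
    one_div, norm_eq_lpNorm, Real.rpow_rpow_inv lpNorm_nonneg hp0.ne']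

lemma sobolevNorm_rpow (u : Sobolev d α p hp) :
    sobolevNorm u ^ p = lpNorm u.1 (ENNReal.ofReal p) volume ^ p +
      lpNorm (increment u.1) (ENNReal.ofReal p) (gagliardoMeasure d α) ^ p := by
  have hp0 : 0 < p := by linarith
  rw [← norm_sobolevEmbedding, norm_sobolevEmbedding_rpow,
    lpNorm_rpow hp0 (Lp.aestronglyMeasurable u.1), lpNorm_rpow hp0 (memLp_increment u).1]

lemma sobolevNorm_nonneg (u : Sobolev d α p hp) : 0 ≤ sobolevNorm u := by
  rw [← norm_sobolevEmbedding, norm_eq_lpNorm]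
  exact lpNorm_nonneg

lemma lpNorm_le_sobolevNorm (u : Sobolev d α p hp) :
    lpNorm u.1 (ENNReal.ofReal p) volume ≤ sobolevNorm u := by
  refine (Real.rpow_le_rpow_iff lpNorm_nonneg (sobolevNorm_nonneg u) (by linarith : 0 < p)).1 ?_
  rw [sobolevNorm_rpow]
  exact le_add_of_nonneg_right (Real.rpow_nonneg lpNorm_nonneg p)

lemma lpNorm_increment_le_sobolevNorm (u : Sobolev d α p hp) :
    lpNorm (increment u.1) (ENNReal.ofReal p) (gagliardoMeasure d α) ≤ sobolevNorm u := by
  refine (Real.rpow_le_rpow_iff lpNorm_nonneg (sobolevNorm_nonneg u) (by linarith : 0 < p)).1 ?_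
  rw [sobolevNorm_rpow]
  exact le_add_of_nonneg_left (Real.rpow_nonneg lpNorm_nonneg p)

lemma injective_sobolevEmbedding : Function.Injective (sobolevEmbedding d α p hp) := by
  intro u v h
  have h' : withIncrement u.1 =ᵐ[sobolevMeasure d α] withIncrement v.1 := by
    refine (coeFn_sobolevEmbedding u).symm.trans ?_
    rw [h]
    exact coeFn_sobolevEmbedding v
  exact Subtype.ext (Lp.ext (ae_sumMeasure_iff.1 h').1)

lemma mem_range_sobolevEmbedding_iff {g : Lp ℝ (ENNReal.ofReal p) (sobolevMeasure d α)} :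
    g ∈ Set.range (sobolevEmbedding d α p hp) ↔
      g ∘ Sum.inr =ᵐ[gagliardoMeasure d α] increment (g ∘ Sum.inl) := by
  have hp0 : 0 < p := by linarith
  constructor
  · rintro ⟨u, rfl⟩
    obtain ⟨hl, hr⟩ := ae_sumMeasure_iff.1 (coeFn_sobolevEmbedding u)
    exact EventuallyEq.trans hr (increment_ae_eq hl).symm
  · intro h
    obtain ⟨gl, gr⟩ := (memLp_sumMeasure_iff hp0).1 (Lp.memLp g)
    have hco : gl.toLp =ᵐ[volume] g ∘ Sum.inl := gl.coeFn_toLp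
    have hmem : gl.toLp ∈ Sobolev d α p hp :=
      (memLp_increment_iff hp0 (Lp.aestronglyMeasurable _)).1
        (gr.ae_eq (h.trans (increment_ae_eq hco).symm))
    refine ⟨⟨gl.toLp, hmem⟩, Lp.ext ((coeFn_sobolevEmbedding _).trans ?_)⟩
    exact ae_sumMeasure_iff.2 ⟨hco, (increment_ae_eq hco).trans h.symm⟩

lemma isClosed_range_sobolevEmbedding [Fact (1 ≤ ENNReal.ofReal p)] :
    IsClosed (Set.range (sobolevEmbedding d α p hp)) := by
  refine IsSeqClosed.isClosed fun x g hx hg => ?_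
  simp only [mem_range_sobolevEmbedding_iff] at hx ⊢
  obtain ⟨ns, -, hns⟩ := (tendstoInMeasure_of_tendsto_Lp hg).exists_seq_tendsto_ae
  obtain ⟨hl, hr⟩ := ae_sumMeasure_iff.1 hns
  have hl1 := gagliardoMeasure_absolutelyContinuous (α := α).ae_le
    (Measure.quasiMeasurePreserving_fst.ae hl)
  have hl2 := gagliardoMeasure_absolutelyContinuous (α := α).ae_le
    (Measure.quasiMeasurePreserving_snd.ae hl)
  filter_upwards [hl1, hl2, hr, ae_all_iff.2 hx] with z h1 h2 h3 hxz
  exact tendsto_nhds_unique h3 ((h2.sub h1).congr fun k => (hxz (ns k)).symm)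

/-- The weight on `ℝ^d ⊕ ℝ^d × ℝ^d` belonging to the mass coefficient `m * ν` and the kernel `a`;
the factor `1 / 2` is that of `energyForm`. -/
def sumWeight (m : ℝ) (ν : Rd d → ℝ) (a : Rd d × Rd d → ℝ) : Rd d ⊕ (Rd d × Rd d) → ℝ :=
  Sum.elim (fun x => m * ν x) fun z => a z / 2

lemma IsElliptic.sumWeight {m c C c' C' : ℝ} (hm : 0 < m) {ν : Rd d → ℝ}
    (hν : IsElliptic volume c C ν) {a : Rd d × Rd d → ℝ} (ha : IsElliptic volume c' C' a) :
    IsElliptic (sobolevMeasure d α) (min (m * c) (c' / 2)) (max (m * C) (C' / 2))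
      (sumWeight m ν a) where
  pos := lt_min (mul_pos hm hν.pos) (half_pos ha.pos)
  aestronglyMeasurable := aestronglyMeasurable_sumMeasure_iff.2
    ⟨hν.aestronglyMeasurable.const_mul m, ((ha.aestronglyMeasurable.const_mul 2⁻¹).mono_ac
      gagliardoMeasure_absolutelyContinuous).congr (.of_forall fun z => inv_mul_eq_div 2 (a z))⟩
  lower
    | .inl x => (min_le_left _ _).trans (mul_le_mul_of_nonneg_left (hν.lower x) hm.le)
    | .inr z => (min_le_right _ _).trans (div_le_div_of_nonneg_right (ha.lower z) zero_le_two)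
  upper
    | .inl x => (mul_le_mul_of_nonneg_left (hν.upper x) hm.le).trans (le_max_left _ _)
    | .inr z => (div_le_div_of_nonneg_right (ha.upper z) zero_le_two).trans (le_max_right _ _)

lemma weightedForm_sobolevEmbedding {m c C : ℝ} {ν : Rd d → ℝ} {a : Rd d × Rd d → ℝ}
    (hw : IsElliptic (sobolevMeasure d α) c C (sumWeight m ν a)) (u v : Sobolev d α p hp) :
    weightedForm (sumWeight m ν a) (sobolevEmbedding d α p hp u) (sobolevEmbedding d α p hp v) =
      (∫ x, m * ν x * (signedPow p (u.1 x) * v.1 x)) +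
      ∫ z, a z / 2 * (signedPow p (increment u.1 z) * increment v.1 z) ∂gagliardoMeasure d α := by
  refine Eq.trans (integral_congr_ae ?_) (integral_sumMeasure (hw.integrable_mul
    (integrable_signedPow_mul hp (memLp_withIncrement u) (memLp_withIncrement v))))
  filter_upwards [coeFn_sobolevEmbedding u, coeFn_sobolevEmbedding v] with x h1 h2
  rw [h1, h2]

lemma energyForm_eq (a : Rd d → Rd d → ℝ) (u v : Rd d → ℝ) : energyForm α p a u v =
    ∫ z, a z.1 z.2 / 2 * (signedPow p (increment u z) * increment v z) ∂gagliardoMeasure d α := by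
  rw [integral_gagliardoMeasure, energyForm, ← integral_const_mul]
  refine integral_congr_ae (.of_forall fun z => ?_)
  simp only [increment]
  ring

lemma isWeakSolution_iff {m c C : ℝ} {Λ : Rd d → Rd d → ℝ} {ν f : Rd d → ℝ}
    (hw : IsElliptic (sobolevMeasure d α) c C (sumWeight m ν fun z => ν z.1 * Λ z.1 z.2))
    {u : Sobolev d α p hp} :
    IsWeakSolution m Λ ν f u ↔ ∀ v : Sobolev d α p hp,
      weightedForm (sumWeight m ν fun z => ν z.1 * Λ z.1 z.2)
        (sobolevEmbedding d α p hp u) (sobolevEmbedding d α p hp v) =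
      -∫ x, ν x * f x * v.1 x := by
  refine forall_congr' fun v => ?_
  have hmass : m * ∫ x, signedPow p (u.1 x) * v.1 x * ν x =
      ∫ x, m * ν x * (signedPow p (u.1 x) * v.1 x) := by
    rw [← integral_const_mul]
    exact integral_congr_ae (.of_forall fun x => by ring)
  have hsource : ∫ x, f x * v.1 x * ν x = ∫ x, ν x * f x * v.1 x :=
    integral_congr_ae (.of_forall fun x => by ring)
  rw [weightedForm_sobolevEmbedding hw, energyForm_eq, hmass, hsource, neg_sub_left,
    neg_eq_iff_eq_neg, add_comm]

end SobolevSpace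

/-! ### Averages over translates -/

section Translates

lemma tendsto_lpNorm_zero {Ω ι : Type*} [MeasurableSpace Ω] {ρ : Measure Ω} {q : ℝ} {l : Filter ι}
    {G : ι → Ω → ℝ} (hq : 0 < q) (hG : ∀ᶠ i in l, AEStronglyMeasurable (G i) ρ)
    (h : Tendsto (fun i => ∫ x, |G i x| ^ q ∂ρ) l (𝓝 0)) :
    Tendsto (fun i => lpNorm (G i) (ENNReal.ofReal q) ρ) l (𝓝 0) := by
  have hroot := h.rpow_const (Or.inr (inv_nonneg.2 hq.le))
  rw [Real.zero_rpow (inv_ne_zero hq.ne')] at hroot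
  refine hroot.congr' ?_
  filter_upwards [hG] with i hi
  rw [← lpNorm_rpow hq hi, Real.rpow_rpow_inv lpNorm_nonneg hq.ne']

variable {E : Type*} [AddGroup E] [MeasurableSpace E] [MeasurableAdd₂ E] {μ π : Measure E}
  {p q : ℝ} {B v : E → ℝ}

/-- The average of `B` over the translates of the probability measure `π`. -/
def translateAverage (π : Measure E) (B : E → ℝ) (x : E) : ℝ := ∫ h, B (h + x) ∂π

variable [SFinite μ] [μ.IsAddLeftInvariant] [IsProbabilityMeasure π]

lemma measurePreserving_translate :
    MeasurePreserving (fun z : E × E => z.2 + z.1) (μ.prod π) μ :=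
  measurePreserving_snd.comp (measurePreserving_prod_add_swap μ π)

lemma ae_memLp_translate (hq : 0 < q) (hB : MemLp B (ENNReal.ofReal q) μ) :
    ∀ᵐ x ∂μ, MemLp (fun h => B (h + x)) (ENNReal.ofReal q) π := by
  have hBt := hB.comp_measurePreserving (measurePreserving_translate (π := π))
  filter_upwards [(integrable_abs_rpow hq hBt).prod_right_ae, hBt.1.prodMk_left] with x hx hm
  exact (memLp_iff_integrable_abs_rpow hq hm).2 hx

lemma aestronglyMeasurable_translateAverage (hB : AEStronglyMeasurable B μ) :
    AEStronglyMeasurable (translateAverage π B) μ :=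
  (hB.comp_measurePreserving (measurePreserving_translate (π := π))).integral_prod_right'

lemma memLp_translateAverage (hpq : p.HolderConjugate q) (hB : MemLp B (ENNReal.ofReal q) μ) :
    MemLp (translateAverage π B) (ENNReal.ofReal q) μ := by
  have hq := hpq.symm.pos
  have hmeas := aestronglyMeasurable_translateAverage (π := π) hB.1
  have hBt := integrable_abs_rpow hq
    (hB.comp_measurePreserving (measurePreserving_translate (π := π)))
  rw [memLp_iff_integrable_abs_rpow hq hmeas]
  refine hBt.integral_prod_left.mono' ((continuous_abs_rpow hq.le).comp_aestronglyMeasurable hmeas)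
    ?_
  filter_upwards [ae_memLp_translate (π := π) hq hB] with x hx
  have holder := abs_integral_mul_le_lpNorm_mul_lpNorm hpq hx (memLp_const (1 : ℝ))
  simp only [mul_one, lpNorm_const (ENNReal.ofReal_pos.2 hpq.pos).ne' (NeZero.ne π),
    norm_one, probReal_univ, Real.one_rpow] at holder
  calc ‖|translateAverage π B x| ^ q‖ = |translateAverage π B x| ^ q :=
        Real.norm_of_nonneg (by positivity)
    _ ≤ lpNorm (fun h => B (h + x)) (ENNReal.ofReal q) π ^ q :=
        Real.rpow_le_rpow (abs_nonneg _) holder hq.le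
    _ = ∫ h, |B (h + x)| ^ q ∂π := lpNorm_rpow hq hx.1

lemma integral_comp_translate {f : E → ℝ} (hf : AEStronglyMeasurable f μ) :
    ∫ z : E × E, f (z.2 + z.1) ∂(μ.prod π) = ∫ x, f x ∂μ := by
  have translate := measurePreserving_translate (μ := μ) (π := π)
  rw [← integral_map translate.aemeasurable (by rwa [translate.map_eq]), translate.map_eq]

lemma integral_mul_eq_translate (hpq : p.HolderConjugate q)
    (hB : MemLp B (ENNReal.ofReal q) μ) (hv : MemLp v (ENNReal.ofReal p) μ) :
    ∫ x, B x * v x ∂μ =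
      ∫ z : E × E, B (z.2 + z.1) * (v (z.2 + z.1) - v z.1) ∂(μ.prod π) +
        ∫ x, translateAverage π B x * v x ∂μ := by
  have translate := measurePreserving_translate (μ := μ) (π := π)
  have hint := integrable_mul_of_holderConjugate hpq hB hv
  have hint₁ : Integrable (fun z : E × E => B (z.2 + z.1) * v z.1) (μ.prod π) :=
    integrable_mul_of_holderConjugate hpq (hB.comp_measurePreserving translate)
      (hv.comp_measurePreserving measurePreserving_fst)
  have hint₂ : Integrable (fun z : E × E => B (z.2 + z.1) * v (z.2 + z.1)) (μ.prod π) :=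
    translate.integrable_comp_of_integrable hint
  have average : ∫ z : E × E, B (z.2 + z.1) * v z.1 ∂(μ.prod π) =
      ∫ x, translateAverage π B x * v x ∂μ := by
    simp only [integral_prod _ hint₁, integral_mul_const, translateAverage]
  simp only [mul_sub]
  rw [integral_sub hint₂ hint₁, average, integral_comp_translate hint.1, sub_add_cancel]

lemma abs_integral_mul_le_translate (hpq : p.HolderConjugate q)
    (hB : MemLp B (ENNReal.ofReal q) μ) (hv : MemLp v (ENNReal.ofReal p) μ) :
    |∫ x, B x * v x ∂μ| ≤ lpNorm B (ENNReal.ofReal q) μ *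
        lpNorm (fun z : E × E => v (z.2 + z.1) - v z.1) (ENNReal.ofReal p) (μ.prod π) +
      lpNorm (translateAverage π B) (ENNReal.ofReal q) μ * lpNorm v (ENNReal.ofReal p) μ := by
  have translate := measurePreserving_translate (μ := μ) (π := π)
  have hBt : MemLp (fun z : E × E => B (z.2 + z.1)) (ENNReal.ofReal q) (μ.prod π) :=
    hB.comp_measurePreserving translate
  have hBnorm : lpNorm (fun z : E × E => B (z.2 + z.1)) (ENNReal.ofReal q) (μ.prod π) =
      lpNorm B (ENNReal.ofReal q) μ := by
    rw [← toReal_eLpNorm hBt.1, ← toReal_eLpNorm hB.1]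
    exact congrArg ENNReal.toReal (eLpNorm_comp_measurePreserving hB.1 translate)
  have hvt : MemLp (fun z : E × E => v (z.2 + z.1) - v z.1) (ENNReal.ofReal p) (μ.prod π) :=
    (hv.comp_measurePreserving translate).sub (hv.comp_measurePreserving measurePreserving_fst)
  rw [integral_mul_eq_translate (π := π) hpq hB hv, ← hBnorm]
  exact (abs_add_le _ _).trans (add_le_add
    (abs_integral_mul_le_lpNorm_mul_lpNorm hpq hBt hvt)
    (abs_integral_mul_le_lpNorm_mul_lpNorm hpq (memLp_translateAverage hpq hB) hv))

lemma tendsto_lpNorm_translateAverage {ι : Type*} {l : Filter ι} [l.IsCountablyGenerated]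
    (hpq : p.HolderConjugate q) {B : ι → E → ℝ} {g : E → ℝ}
    (hB : ∀ᶠ i in l, AEStronglyMeasurable (B i) μ) (hBg : ∀ i x, |B i x| ≤ g x)
    (hg : MemLp g (ENNReal.ofReal q) μ)
    (h : ∀ x, Tendsto (fun i => translateAverage π (B i) x) l (𝓝 0)) :
    Tendsto (fun i => lpNorm (translateAverage π (B i)) (ENNReal.ofReal q) μ) l (𝓝 0) := by
  have hq := hpq.symm.pos
  have hmeas : ∀ᶠ i in l, AEStronglyMeasurable (translateAverage π (B i)) μ :=
    hB.mono fun i hi => aestronglyMeasurable_translateAverage hi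
  refine tendsto_lpNorm_zero hq hmeas ?_
  rw [← integral_zero E ℝ (μ := μ)]
  refine tendsto_integral_filter_of_dominated_convergence
    (fun x => |translateAverage π g x| ^ q)
    (hmeas.mono fun i hi => (continuous_abs_rpow hq.le).comp_aestronglyMeasurable hi)
    (.of_forall fun i => ?_) (integrable_abs_rpow hq (memLp_translateAverage hpq hg))
    (.of_forall fun x => ?_)
  · filter_upwards [ae_memLp_translate (π := π) hq hg] with x hx
    rw [Real.norm_of_nonneg (by positivity)]
    have hle : |translateAverage π (B i) x| ≤ translateAverage π g x := by
      rw [translateAverage, ← Real.norm_eq_abs]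
      exact norm_integral_le_of_norm_le (hx.integrable (ENNReal.one_le_ofReal.2 hpq.symm.lt.le))
        (.of_forall fun h => hBg i (h + x))
    exact Real.rpow_le_rpow (abs_nonneg _) (hle.trans (le_abs_self _)) hq.le
  · simpa only [abs_zero, Real.zero_rpow hq.ne', Function.comp_def] using
      ((continuous_abs_rpow hq.le).tendsto 0).comp (h x)

end Translates

/-! ### Uniform convergence of functionals on the Sobolev space -/

section UniformConvergence

lemma DualTendstoZero.of_forall_exists {ι V : Type*} {l : Filter ι} {N : V → ℝ} {F : ι → V → ℝ}
    (h : ∀ δ > 0, ∃ G, DualTendstoZero N l G ∧ ∀ᶠ i in l, ∀ v, |F i v - G i v| ≤ δ * N v) :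
    DualTendstoZero N l F := fun τ hτ => by
  obtain ⟨G, hG, hFG⟩ := h _ (half_pos hτ)
  filter_upwards [hG _ (half_pos hτ), hFG] with i hi hFGi v
  linarith [abs_sub_abs_le_abs_sub (F i v) (G i v), hi v, hFGi v]

variable {d : ℕ} {α p q : ℝ} {hp : 1 < p} {r : ℝ}

/-- The uniform probability measure on the ball of radius `r` around the origin. -/
def uniformBall (d : ℕ) (r : ℝ) : Measure (Rd d) :=
  ProbabilityTheory.cond volume (Metric.ball 0 r)

lemma isProbabilityMeasure_uniformBall (hr : 0 < r) : IsProbabilityMeasure (uniformBall d r) :=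
  ProbabilityTheory.cond_isProbabilityMeasure_of_finite
    (Metric.measure_ball_pos volume 0 hr).ne' measure_ball_lt_top.ne

lemma translateAverage_uniformBall (B : Rd d → ℝ) (x : Rd d) :
    translateAverage (uniformBall d r) B x =
      (volume.real (Metric.ball (0 : Rd d) r))⁻¹ * ∫ y in Metric.ball x r, B y := by
  have hball : (· + x) ⁻¹' Metric.ball x r = Metric.ball 0 r := by
    ext y
    simp only [Set.mem_preimage, Metric.mem_ball, dist_eq_norm, add_sub_cancel_right,
      sub_zero]
  rw [translateAverage, uniformBall, ProbabilityTheory.cond, integral_smul_measure,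
    ENNReal.toReal_inv, smul_eq_mul, ← hball, (measurePreserving_add_right volume
      x).setIntegral_preimage_emb (measurableEmbedding_addRight x)]
  rfl

lemma volume_real_ball (hr : 0 < r) :
    volume.real (Metric.ball (0 : Rd d) r) = r ^ d * volume.real (Metric.ball (0 : Rd d) 1) := by
  rw [Measure.real, Measure.addHaar_ball_of_pos _ _ hr, finrank_euclideanSpace_fin,
    ENNReal.toReal_mul, ENNReal.toReal_ofReal (by positivity), Measure.real]

lemma integral_prod_uniformBall (F : Rd d × Rd d → ℝ) :
    ∫ z, F (z.1, z.2 + z.1) ∂(volume.prod (uniformBall d r)) =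
      (volume.real (Metric.ball (0 : Rd d) r))⁻¹ *
        ∫ z in {z : Rd d × Rd d | ‖z.1 - z.2‖ < r}, F z := by
  have hshear : (fun z : Rd d × Rd d => (z.1, z.2 + z.1)) ⁻¹' {z | ‖z.1 - z.2‖ < r} =
      Set.univ ×ˢ Metric.ball 0 r := by
    ext z
    simp only [Set.mem_preimage, Set.mem_ofPred_eq, Set.mem_prod, Set.mem_univ, true_and,
      Metric.mem_ball, dist_zero_right, sub_add_cancel_right, norm_neg]
  have hequiv : (fun z : Rd d × Rd d => (z.1, z.2 + z.1)) = MeasurableEquiv.shearAddRight (Rd d) :=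
    funext fun z => Prod.ext rfl (add_comm _ _)
  have hpres : MeasurePreserving (fun z : Rd d × Rd d => (z.1, z.2 + z.1)) volume volume := by
    rw [hequiv]
    exact measurePreserving_prod_add volume volume
  have hemb : MeasurableEmbedding fun z : Rd d × Rd d => (z.1, z.2 + z.1) := by
    rw [hequiv]
    exact (MeasurableEquiv.shearAddRight (Rd d)).measurableEmbedding
  rw [uniformBall, ProbabilityTheory.cond, Measure.prod_smul_right, integral_smul_measure,
    ENNReal.toReal_inv, smul_eq_mul, ← hpres.setIntegral_preimage_emb hemb, hshear,
    Measure.volume_eq_prod, ← Measure.prod_restrict, Measure.restrict_univ, Measure.real]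

lemma setIntegral_le_mul_integral_gagliardoMeasure (hα : 0 < α) (hr : 0 < r)
    {F : Rd d × Rd d → ℝ} (hF : ∀ z, 0 ≤ F z) (hdiag : ∀ x, F (x, x) = 0)
    (hint : Integrable F (gagliardoMeasure d α)) :
    ∫ z in {z : Rd d × Rd d | ‖z.1 - z.2‖ < r}, F z ≤
      r ^ ((d : ℝ) + α) * ∫ z, F z ∂gagliardoMeasure d α := by
  have hint' : Integrable fun z => r ^ ((d : ℝ) + α) * ((‖z.1 - z.2‖ ^ ((d : ℝ) + α))⁻¹ * F z) :=
    (integrable_gagliardoMeasure_iff.1 hint).const_mul _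
  have hnonneg (z : Rd d × Rd d) :
      0 ≤ r ^ ((d : ℝ) + α) * ((‖z.1 - z.2‖ ^ ((d : ℝ) + α))⁻¹ * F z) := by
    have := hF z
    positivity
  rw [integral_gagliardoMeasure, ← integral_const_mul]
  refine (integral_mono_of_nonneg (.of_forall hF) hint'.restrict ?_).trans
    (setIntegral_le_integral hint' (.of_forall hnonneg))
  filter_upwards [ae_restrict_mem (measurableSet_lt (by fun_prop) measurable_const)] with z hz
  obtain ⟨x, y⟩ := z
  rcases eq_or_ne x y with rfl | hxy
  · exact (hdiag x).trans_le (hnonneg (x, x))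
  · have hpos : 0 < ‖x - y‖ ^ ((d : ℝ) + α) :=
      Real.rpow_pos_of_pos (norm_pos_iff.2 (sub_ne_zero.2 hxy)) _
    rw [← mul_assoc, ← div_eq_mul_inv]
    exact le_mul_of_one_le_left (hF _) ((one_le_div hpos).2
      (Real.rpow_le_rpow (norm_nonneg _) hz.le (by positivity)))

lemma lpNorm_translate_sub_rpow_le (hα : 0 < α) (hr : 0 < r) (u : Sobolev d α p hp) :
    lpNorm (fun z : Rd d × Rd d => u.1 (z.2 + z.1) - u.1 z.1) (ENNReal.ofReal p)
        (volume.prod (uniformBall d r)) ^ p ≤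
      r ^ α / volume.real (Metric.ball (0 : Rd d) 1) * sobolevNorm u ^ p := by
  have hp0 : 0 < p := by linarith
  have := isProbabilityMeasure_uniformBall (d := d) hr
  have hu := Lp.memLp u.1
  have hmeas : AEStronglyMeasurable (fun z : Rd d × Rd d => u.1 (z.2 + z.1) - u.1 z.1)
      (volume.prod (uniformBall d r)) :=
    (hu.1.comp_measurePreserving measurePreserving_translate).sub
      (hu.1.comp_measurePreserving measurePreserving_fst)
  have hincr : lpNorm (increment u.1) (ENNReal.ofReal p) (gagliardoMeasure d α) ^ p ≤
      sobolevNorm u ^ p :=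
    Real.rpow_le_rpow lpNorm_nonneg (lpNorm_increment_le_sobolevNorm u) hp0.le
  calc lpNorm (fun z : Rd d × Rd d => u.1 (z.2 + z.1) - u.1 z.1) (ENNReal.ofReal p)
          (volume.prod (uniformBall d r)) ^ p
      = (volume.real (Metric.ball (0 : Rd d) r))⁻¹ *
          ∫ z in {z : Rd d × Rd d | ‖z.1 - z.2‖ < r}, |increment u.1 z| ^ p :=
        (lpNorm_rpow hp0 hmeas).trans
          (integral_prod_uniformBall fun z => |increment u.1 z| ^ p)
    _ ≤ (volume.real (Metric.ball (0 : Rd d) r))⁻¹ * (r ^ ((d : ℝ) + α) *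
          lpNorm (increment u.1) (ENNReal.ofReal p) (gagliardoMeasure d α) ^ p) := by
        rw [lpNorm_rpow hp0 (memLp_increment u).1]
        gcongr
        refine setIntegral_le_mul_integral_gagliardoMeasure hα hr (fun z => by positivity)
          (fun x => ?_) (integrable_abs_rpow hp0 (memLp_increment u))
        rw [increment, sub_self, abs_zero, Real.zero_rpow hp0.ne']
    _ ≤ r ^ α / volume.real (Metric.ball (0 : Rd d) 1) * sobolevNorm u ^ p := by
        rw [← mul_assoc, volume_real_ball hr, Real.rpow_add hr, Real.rpow_natCast, inv_mul_eq_div,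
          mul_div_mul_left _ _ (pow_pos hr d).ne']
        gcongr

lemma lpNorm_translate_sub_le (hα : 0 < α) (hr : 0 < r) (u : Sobolev d α p hp) :
    lpNorm (fun z : Rd d × Rd d => u.1 (z.2 + z.1) - u.1 z.1) (ENNReal.ofReal p)
        (volume.prod (uniformBall d r)) ≤
      (r ^ α / volume.real (Metric.ball (0 : Rd d) 1)) ^ p⁻¹ * sobolevNorm u := by
  have hp0 : 0 < p := by linarith
  have hball : 0 ≤ r ^ α / volume.real (Metric.ball (0 : Rd d) 1) := by positivity
  refine (Real.rpow_le_rpow_iff lpNorm_nonneg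
    (mul_nonneg (by positivity) (sobolevNorm_nonneg u)) hp0).1 ?_
  rw [Real.mul_rpow (by positivity) (sobolevNorm_nonneg u), Real.rpow_inv_rpow hball hp0.ne']
  exact lpNorm_translate_sub_rpow_le hα hr u

variable {ι : Type*} {l : Filter ι} [l.IsCountablyGenerated]

/-- Replacing `B i` by its averages over balls of radius `r` costs `r ^ (α / p)` in the dual norm,
uniformly in `i`, and the averages tend to zero in `L^q` by dominated convergence. -/
lemma dualTendstoZero_of_tendsto_setIntegral_ball (hα : 0 < α) (hpq : p.HolderConjugate q)
    {B : ι → Rd d → ℝ} {g : Rd d → ℝ} (hB : ∀ᶠ i in l, AEStronglyMeasurable (B i) volume)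
    (hBg : ∀ i x, |B i x| ≤ g x) (hg : MemLp g (ENNReal.ofReal q) volume)
    (h : ∀ x r, Tendsto (fun i => ∫ y in Metric.ball x r, B i y) l (𝓝 0)) :
    DualTendstoZero sobolevNorm l fun i (v : Sobolev d α p hp) => ∫ x, B i x * v.1 x := by
  intro τ hτ
  have hshift : Tendsto (fun r : ℝ => lpNorm g (ENNReal.ofReal q) volume *
      (r ^ α / volume.real (Metric.ball (0 : Rd d) 1)) ^ p⁻¹) (𝓝[>] 0) (𝓝 0) := by
    have hcont : Continuous fun r : ℝ => lpNorm g (ENNReal.ofReal q) volume *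
        (r ^ α / volume.real (Metric.ball (0 : Rd d) 1)) ^ p⁻¹ :=
      (((Real.continuous_rpow_const hα.le).div_const _).rpow_const
        fun _ => Or.inr (inv_nonneg.2 hpq.pos.le)).const_mul _
    refine (hcont.tendsto' 0 0 ?_).mono_left nhdsWithin_le_nhds
    rw [Real.zero_rpow hα.ne', zero_div, Real.zero_rpow (inv_ne_zero hpq.ne_zero), mul_zero]
  obtain ⟨r, hrτ, hr⟩ :=
    ((hshift.eventually_le_const (half_pos hτ)).and self_mem_nhdsWithin).exists
  have := isProbabilityMeasure_uniformBall (d := d) hr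
  have haverage := tendsto_lpNorm_translateAverage hpq (π := uniformBall d r) hB hBg hg
    fun x => by simpa only [translateAverage_uniformBall, mul_zero] using (h x r).const_mul _
  filter_upwards [hB, haverage.eventually_le_const (half_pos hτ)] with i hBi hi v
  have hBmem : MemLp (B i) (ENNReal.ofReal q) volume := hg.mono' hBi (.of_forall (hBg i))
  have hBnorm : lpNorm (B i) (ENNReal.ofReal q) volume ≤ lpNorm g (ENNReal.ofReal q) volume :=
    lpNorm_mono_real hg fun x => hBg i x
  calc |∫ x, B i x * v.1 x| ≤ _ :=
        abs_integral_mul_le_translate (π := uniformBall d r) hpq hBmem (Lp.memLp v.1)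
    _ ≤ lpNorm g (ENNReal.ofReal q) volume *
          ((r ^ α / volume.real (Metric.ball (0 : Rd d) 1)) ^ p⁻¹ * sobolevNorm v) +
        τ / 2 * sobolevNorm v := by
        exact add_le_add (mul_le_mul hBnorm (lpNorm_translate_sub_le hα hr v) lpNorm_nonneg
          lpNorm_nonneg) (mul_le_mul hi (lpNorm_le_sobolevNorm v) lpNorm_nonneg (half_pos hτ).le)
    _ ≤ τ * sobolevNorm v := by
        rw [← mul_assoc, ← add_mul]
        exact mul_le_mul_of_nonneg_right (by linarith) (sobolevNorm_nonneg v)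

lemma TendstoWeakStarZero.dualTendstoZero {C : ℝ} {b : ι → Rd d → ℝ} {g : Rd d → ℝ}
    (hb : TendstoWeakStarZero volume C l b) (hα : 0 < α) (hpq : p.HolderConjugate q)
    (hg : MemLp g (ENNReal.ofReal q) volume) :
    DualTendstoZero sobolevNorm l fun i (v : Sobolev d α p hp) => ∫ x, b i x * g x * v.1 x := by
  refine dualTendstoZero_of_tendsto_setIntegral_ball hα hpq
    (hb.aestronglyMeasurable.mono fun i hi => hi.mul hg.1)
    (fun i x => (abs_mul _ _).trans_le (mul_le_mul_of_nonneg_right (hb.bound i x) (abs_nonneg _)))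
    (hg.abs.const_mul C) fun x r => ?_
  have : IsFiniteMeasure (volume.restrict (Metric.ball x r)) :=
    isFiniteMeasure_restrict.2 measure_ball_lt_top.ne
  have hint : Integrable ((Metric.ball x r).indicator g) volume :=
    (integrable_indicator_iff measurableSet_ball).2 ((hg.restrict _).integrable
      (ENNReal.one_le_ofReal.2 hpq.symm.lt.le))
  refine (hb.tendsto_integral _ hint).congr fun i => ?_
  simp only [← integral_indicator measurableSet_ball, Set.indicator_mul_right]

end UniformConvergence

/-! ### Oscillating kernels tested against increments -/

section Increments

lemma tendsto_lpNorm_indicator_lt {Ω : Type*} [MeasurableSpace Ω] {ρ : Measure Ω} {q : ℝ}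
    {G φ : Ω → ℝ} (hq : 0 < q) (hG : MemLp G (ENNReal.ofReal q) ρ) (hφ : Measurable φ) :
    Tendsto (fun n : ℕ => lpNorm ({x | n < φ x}.indicator G) (ENNReal.ofReal q) ρ) atTop
      (𝓝 0) := by
  have hmeas (n : ℕ) : AEStronglyMeasurable ({x | n < φ x}.indicator G) ρ :=
    hG.1.indicator (measurableSet_lt measurable_const hφ)
  refine tendsto_lpNorm_zero hq (.of_forall hmeas) ?_
  rw [← integral_zero Ω ℝ (μ := ρ)]
  refine tendsto_integral_of_dominated_convergence (fun x => |G x| ^ q)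
    (fun n => (continuous_abs_rpow hq.le).comp_aestronglyMeasurable (hmeas n))
    (integrable_abs_rpow hq hG) (fun n => .of_forall fun x => ?_) (.of_forall fun x => ?_)
  · rw [Real.norm_of_nonneg (by positivity)]
    exact Real.rpow_le_rpow (abs_nonneg _) (norm_indicator_le_norm_self G x) hq.le
  · obtain ⟨N, hN⟩ := exists_nat_ge (φ x)
    refine tendsto_const_nhds.congr' ?_
    filter_upwards [eventually_ge_atTop N] with n hn
    have hx : x ∉ {x | n < φ x} := not_lt.2 (hN.trans (Nat.cast_le.2 hn))
    rw [Set.indicator_of_notMem hx, abs_zero, Real.zero_rpow hq.ne']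

variable {ι : Type*} {l : Filter ι}

lemma TendstoWeakStarZero.mul {X : Type*} [MeasurableSpace X] {μ : Measure X} {C K : ℝ}
    {b : ι → X → ℝ} (hb : TendstoWeakStarZero μ C l b) {H : X → ℝ}
    (hH : AEStronglyMeasurable H μ) (hHK : ∀ x, |H x| ≤ K) :
    TendstoWeakStarZero μ (C * K) l fun i x => b i x * H x where
  bound i x := (abs_mul _ _).trans_le
    (mul_le_mul (hb.bound i x) (hHK x) (abs_nonneg _) ((abs_nonneg _).trans (hb.bound i x)))
  aestronglyMeasurable := hb.aestronglyMeasurable.mono fun i hi => hi.mul hH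
  tendsto_integral g hg := by
    simpa only [mul_assoc] using
      hb.tendsto_integral _ (hg.bdd_mul hH (.of_forall hHK))

variable {d : ℕ} {α p q : ℝ} {hp : 1 < p} {C M R : ℝ} {a b : ι → Rd d × Rd d → ℝ}

lemma TendstoWeakStarZero.swap (ha : TendstoWeakStarZero volume C l a) :
    TendstoWeakStarZero volume C l fun i (z : Rd d × Rd d) => a i z.swap where
  bound i z := ha.bound i z.swap
  aestronglyMeasurable := ha.aestronglyMeasurable.mono fun _ hi =>
    hi.comp_measurePreserving Measure.measurePreserving_swap
  tendsto_integral g hg := (ha.tendsto_integral (fun z => g z.swap) hg.swap).congr fun i =>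
    integral_prod_swap fun z : Rd d × Rd d => a i z.swap * g z

lemma integrable_mul_fst_of_bounded_support {a : Rd d × Rd d → ℝ} {v : Rd d → ℝ} {r : ENNReal}
    (ha : AEStronglyMeasurable a volume) (haM : ∀ z, |a z| ≤ M) (haR : ∀ z, R < ‖z‖ → a z = 0)
    (hr : 1 ≤ r) (hv : MemLp v r volume) : Integrable fun z => a z * v z.1 := by
  have : IsFiniteMeasure ((volume : Measure (Rd d)).restrict (Metric.closedBall 0 R)) :=
    isFiniteMeasure_restrict.2 measure_closedBall_lt_top.ne
  have hsupport : Function.support (fun z => a z * v z.1) ⊆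
      Metric.closedBall 0 R ×ˢ Metric.closedBall 0 R := fun z hz => by
    rw [closedBall_prod_same, Prod.mk_zero_zero, mem_closedBall_zero_iff]
    exact not_lt.1 fun h => hz (by simp only [haR z h, zero_mul])
  rw [← integrableOn_iff_integrable_of_support_subset hsupport]
  have hv' : IntegrableOn (fun z : Rd d × Rd d => v z.1)
      (Metric.closedBall 0 R ×ˢ Metric.closedBall 0 R) := by
    rw [IntegrableOn, Measure.volume_eq_prod, ← Measure.prod_restrict]
    exact ((hv.restrict _).integrable hr).comp_fst _
  exact Integrable.bdd_mul hv' ha.restrict (.of_forall haM)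

lemma abs_integral_snd_le_of_bounded_support {a : Rd d × Rd d → ℝ} (haM : ∀ z, |a z| ≤ M)
    (haR : ∀ z, R < ‖z‖ → a z = 0) (x : Rd d) :
    |∫ y, a (x, y)| ≤ (Metric.closedBall 0 R).indicator
      (fun _ => M * volume.real (Metric.closedBall (0 : Rd d) R)) x := by
  by_cases hx : x ∈ Metric.closedBall 0 R
  · rw [Set.indicator_of_mem hx, ← Real.norm_eq_abs,
      ← setIntegral_eq_integral_of_forall_compl_eq_zero fun y hy => haR (x, y)
        ((not_le.1 fun h => hy (mem_closedBall_zero_iff.2 h)).trans_le (norm_snd_le (x, y)))]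
    exact norm_setIntegral_le_of_norm_le_const measure_closedBall_lt_top fun y _ => haM (x, y)
  · rw [Set.indicator_of_notMem hx, integral_congr_ae (.of_forall fun y => haR (x, y)
      ((not_le.1 fun h => hx (mem_closedBall_zero_iff.2 h)).trans_le (norm_fst_le (x, y)))),
      integral_zero, abs_zero]

lemma TendstoWeakStarZero.tendsto_setIntegral_ball (ha : TendstoWeakStarZero volume M l a)
    (haR : ∀ i z, R < ‖z‖ → a i z = 0) (x : Rd d) (r : ℝ) :
    Tendsto (fun i => ∫ y in Metric.ball x r, ∫ y', a i (y, y')) l (𝓝 0) := by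
  set S : Set (Rd d × Rd d) := Metric.ball x r ×ˢ Metric.closedBall 0 R
  have hS : MeasurableSet S := measurableSet_ball.prod measurableSet_closedBall
  have hSfin : volume S ≠ ⊤ := by
    rw [Measure.volume_eq_prod, Measure.prod_prod]
    exact ENNReal.mul_ne_top measure_ball_lt_top.ne measure_closedBall_lt_top.ne
  have htest : Integrable (S.indicator fun _ => (1 : ℝ)) :=
    (integrable_indicator_iff hS).2 (integrableOn_const hSfin)
  refine (ha.tendsto_integral _ htest).congr' ?_
  filter_upwards [ha.aestronglyMeasurable] with i hi
  have hint : IntegrableOn (a i) S :=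
    Measure.integrableOn_of_bounded hSfin hi (.of_forall (ha.bound i))
  simp only [← Set.indicator_mul_right, mul_one]
  rw [integral_indicator hS, Measure.volume_eq_prod, setIntegral_prod _ hint]
  exact integral_congr_ae (.of_forall fun y => setIntegral_eq_integral_of_forall_compl_eq_zero
    fun y' hy' => haR i (y, y')
      ((not_le.1 fun h => hy' (mem_closedBall_zero_iff.2 h)).trans_le (norm_snd_le (y, y'))))

variable [l.IsCountablyGenerated]

lemma TendstoWeakStarZero.dualTendstoZero_fst (ha : TendstoWeakStarZero volume M l a)
    (haR : ∀ i z, R < ‖z‖ → a i z = 0) (hα : 0 < α) :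
    DualTendstoZero sobolevNorm l fun i (v : Sobolev d α p hp) => ∫ z, a i z * v.1 z.1 := by
  have hmarginal := dualTendstoZero_of_tendsto_setIntegral_ball (hp := hp) hα
    (Real.HolderConjugate.conjExponent hp) (B := fun i x => ∫ y, a i (x, y))
    (ha.aestronglyMeasurable.mono fun i hi => AEStronglyMeasurable.integral_prod_right' hi)
    (fun i => abs_integral_snd_le_of_bounded_support (ha.bound i) (haR i))
    (memLp_indicator_const _ measurableSet_closedBall _ (.inr measure_closedBall_lt_top.ne))
    (ha.tendsto_setIntegral_ball haR)
  intro τ hτ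
  filter_upwards [ha.aestronglyMeasurable, hmarginal τ hτ] with i hi hmarginal v
  have hint := integrable_mul_fst_of_bounded_support hi (ha.bound i) (haR i)
    (ENNReal.one_le_ofReal.2 hp.le) (Lp.memLp v.1)
  rw [Measure.volume_eq_prod, integral_prod _ hint]
  simpa only [integral_mul_const] using hmarginal v

lemma TendstoWeakStarZero.dualTendstoZero_increment_of_bounded_support
    (ha : TendstoWeakStarZero volume M l a) (haR : ∀ i z, R < ‖z‖ → a i z = 0) (hα : 0 < α) :
    DualTendstoZero sobolevNorm l fun i (v : Sobolev d α p hp) =>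
      ∫ z, a i z * increment v.1 z := by
  have haR' (i : ι) (z : Rd d × Rd d) (hz : R < ‖z‖) : a i z.swap = 0 :=
    haR i z.swap (hz.trans_eq (max_comm _ _))
  intro τ hτ
  filter_upwards [ha.aestronglyMeasurable, ha.swap.aestronglyMeasurable,
    ha.dualTendstoZero_fst (hp := hp) haR hα _ (half_pos hτ),
    ha.swap.dualTendstoZero_fst (hp := hp) haR' hα _ (half_pos hτ)] with i hi hi' hfst hsnd v
  have hr := ENNReal.one_le_ofReal.2 hp.le
  have hint₁ := integrable_mul_fst_of_bounded_support hi (ha.bound i) (haR i) hr (Lp.memLp v.1)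
  have hint₂ : Integrable fun z => a i z * v.1 z.2 :=
    (integrable_mul_fst_of_bounded_support hi' (ha.swap.bound i) (haR' i) hr (Lp.memLp v.1)).swap
  have hswap : ∫ z : Rd d × Rd d, a i z * v.1 z.2 =
      ∫ z : Rd d × Rd d, a i z.swap * v.1 z.1 :=
    integral_prod_swap fun z : Rd d × Rd d => a i z.swap * v.1 z.1
  simp only [increment, mul_sub]
  rw [integral_sub hint₂ hint₁, hswap]
  linarith [hfst v, hsnd v,
    abs_sub (∫ z : Rd d × Rd d, a i z.swap * v.1 z.1) (∫ z : Rd d × Rd d, a i z * v.1 z.1)]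

lemma TendstoWeakStarZero.dualTendstoZero_increment_of_truncated
    (hb : TendstoWeakStarZero volume C l b) (hα : 0 < α) {G : Rd d × Rd d → ℝ} (hG : Measurable G)
    (hGM : ∀ z, |G z| ≤ M) (hGR : ∀ z, M < ‖z‖ → G z = 0)
    (hGk : ∀ z, M < singularKernel α z → G z = 0) :
    DualTendstoZero sobolevNorm l fun i (v : Sobolev d α p hp) =>
      ∫ z, b i z * G z * increment v.1 z ∂gagliardoMeasure d α := by
  have hbound (z : Rd d × Rd d) : |singularKernel α z * G z| ≤ M * M := by
    by_cases hz : M < singularKernel α z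
    · rw [hGk z hz, mul_zero, abs_zero]
      exact mul_self_nonneg M
    · rw [abs_mul, NNReal.abs_eq]
      have hM : 0 ≤ M := (abs_nonneg _).trans (hGM z)
      exact mul_le_mul (not_lt.1 hz) (hGM z) (abs_nonneg _) hM
  have hmul := hb.mul ((measurable_singularKernel α).coe_nnreal_real.mul hG).aestronglyMeasurable
    hbound
  intro τ hτ
  filter_upwards [hmul.dualTendstoZero_increment_of_bounded_support
    (fun i z hz => by rw [Pi.mul_apply, hGR z hz, mul_zero, mul_zero]) hα τ hτ] with i hi v
  convert hi v using 2
  rw [integral_gagliardoMeasure]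
  refine integral_congr_ae (.of_forall fun z => ?_)
  simp only [Pi.mul_apply, singularKernel]
  rw [Real.coe_toNNReal _ (by positivity)]
  ring

lemma TendstoWeakStarZero.dualTendstoZero_increment (hb : TendstoWeakStarZero volume C l b)
    (hα : 0 < α) (hpq : p.HolderConjugate q) {G : Rd d × Rd d → ℝ} (hGm : Measurable G)
    (hG : MemLp G (ENNReal.ofReal q) (gagliardoMeasure d α)) :
    DualTendstoZero sobolevNorm l fun i (v : Sobolev d α p hp) =>
      ∫ z, b i z * G z * increment v.1 z ∂gagliardoMeasure d α := by
  refine .of_forall_exists fun δ hδ => ?_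
  set φ : Rd d × Rd d → ℝ := fun z => max ‖z‖ (max (singularKernel α z) |G z|)
  have hφ : Measurable φ := measurable_norm.max
    ((measurable_singularKernel α).coe_nnreal_real.max hGm.abs)
  have htail := (tendsto_lpNorm_indicator_lt hpq.symm.pos hG hφ).const_mul C
  rw [mul_zero] at htail
  obtain ⟨n, hn⟩ := (htail.eventually_le_const hδ).exists
  have hcut (z : Rd d × Rd d) (hz : n < φ z) : {z | n < φ z}ᶜ.indicator G z = 0 :=
    Set.indicator_of_notMem (s := {z | n < φ z}ᶜ) (Set.notMem_compl_iff.2 hz) G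
  have hset : MeasurableSet {z | n < φ z} := measurableSet_lt measurable_const hφ
  refine ⟨_, hb.dualTendstoZero_increment_of_truncated hα (M := n) (hGm.indicator hset.compl)
    (fun z => ?_) (fun z hz => hcut z (lt_max_of_lt_left hz))
    fun z hz => hcut z (lt_max_of_lt_right (lt_max_of_lt_left hz)), ?_⟩
  · by_cases hz : n < φ z
    · rw [hcut z hz, abs_zero]
      exact n.cast_nonneg
    · exact (norm_indicator_le_norm_self G z).trans
        ((le_max_right _ _).trans ((le_max_right _ _).trans (not_lt.1 hz)))
  filter_upwards [hb.aestronglyMeasurable] with i hi v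
  have hi' := hi.mono_ac (gagliardoMeasure_absolutelyContinuous (α := α))
  have hint {G' : Rd d × Rd d → ℝ} (hG' : MemLp G' (ENNReal.ofReal q) (gagliardoMeasure d α)) :=
    integrable_mul_of_holderConjugate hpq (memLp_bdd_mul hi' (hb.bound i) hG') (memLp_increment v)
  have hsplit (z : Rd d × Rd d) : b i z * G z * increment v.1 z -
      b i z * {z | n < φ z}ᶜ.indicator G z * increment v.1 z =
      b i z * {z | n < φ z}.indicator G z * increment v.1 z := by
    rw [← sub_mul, ← mul_sub, ← Set.indicator_self_add_compl_apply {z | n < φ z} G z,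
      add_sub_cancel_right]
  rw [← integral_sub (hint hG) (hint (hG.indicator hset.compl))]
  simp only [hsplit]
  refine (abs_integral_mul_le_lpNorm_mul_lpNorm hpq
    (memLp_bdd_mul hi' (hb.bound i) (hG.indicator hset)) (memLp_increment v)).trans ?_
  exact mul_le_mul ((lpNorm_bdd_mul_le (hb.bound i) (hG.indicator hset)).trans hn)
    (lpNorm_increment_le_sobolevNorm v) lpNorm_nonneg hδ.le

end Increments

/-! ### Convergence of solutions -/

section Solutions

variable {d : ℕ} {α p q m c C c' C' : ℝ} {hp : 1 < p} {ν f : Rd d → ℝ}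

/-- The functional `v ↦ -∫ g v` on the Sobolev space. -/
def sourceFunctional (α : ℝ) (hp : 1 < p) (hpq : p.HolderConjugate q) {g : Rd d → ℝ}
    (hg : MemLp g (ENNReal.ofReal q)) : Sobolev d α p hp →ₗ[ℝ] ℝ where
  toFun v := -∫ x, g x * v.1 x
  map_add' v w := by
    rw [← neg_add, ← integral_add (integrable_mul_of_holderConjugate hpq hg (Lp.memLp v.1))
      (integrable_mul_of_holderConjugate hpq hg (Lp.memLp w.1))]
    refine congrArg Neg.neg (integral_congr_ae ?_)
    filter_upwards [Lp.coeFn_add v.1 w.1] with x hx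
    rw [← mul_add, Submodule.coe_add, hx, Pi.add_apply]
  map_smul' t v := by
    rw [RingHom.id_apply, smul_neg, smul_eq_mul, ← integral_const_mul]
    refine congrArg Neg.neg (integral_congr_ae ?_)
    filter_upwards [Lp.coeFn_smul t v.1] with x hx
    rw [Submodule.coe_smul, hx, Pi.smul_apply, smul_eq_mul, mul_left_comm]

lemma abs_sourceFunctional_le (hpq : p.HolderConjugate q) {g : Rd d → ℝ}
    (hg : MemLp g (ENNReal.ofReal q)) (v : Sobolev d α p hp) :
    |sourceFunctional α hp hpq hg v| ≤
      lpNorm g (ENNReal.ofReal q) volume * ‖sobolevEmbedding d α p hp v‖ := by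
  refine (abs_neg _).trans_le ((abs_integral_mul_le_lpNorm_mul_lpNorm hpq hg
    (Lp.memLp v.1)).trans (mul_le_mul_of_nonneg_left ?_ lpNorm_nonneg))
  rw [norm_sobolevEmbedding]
  exact lpNorm_le_sobolevNorm v

theorem existsUnique_isWeakSolution (hm : 0 < m) (hpq : p.HolderConjugate q)
    {Λ : Rd d → Rd d → ℝ} (hν : IsElliptic volume c C ν)
    (ha : IsElliptic volume c' C' fun z : Rd d × Rd d => ν z.1 * Λ z.1 z.2)
    (hf : MemLp f (ENNReal.ofReal q)) :
    ∃! u : Sobolev d α p hp, IsWeakSolution m Λ ν f u := by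
  have : Fact (1 ≤ ENNReal.ofReal p) := ⟨ENNReal.one_le_ofReal.2 hp.le⟩
  have hw := IsElliptic.sumWeight (α := α) hm hν ha
  refine (existsUnique_congr fun u => isWeakSolution_iff hw).2
    (existsUnique_weightedForm_eq hp hw injective_sobolevEmbedding isClosed_range_sobolevEmbedding
      (abs_sourceFunctional_le hpq (memLp_bdd_mul hν.aestronglyMeasurable hν.abs_le hf)))

/-- At a fixed `u`, the residual of the weak equation is linear in the pair of coefficients
`(ν, a)`, so that weak-star convergence of the coefficients applies to it. -/
lemma residual_eq (hm : 0 < m) (hpq : p.HolderConjugate q) {a : Rd d × Rd d → ℝ}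
    (hν : IsElliptic volume c C ν) (ha : IsElliptic volume c' C' a)
    (hf : MemLp f (ENNReal.ofReal q)) (u v : Sobolev d α p hp) :
    (-∫ x, ν x * f x * v.1 x) - weightedForm (sumWeight m ν a)
      (sobolevEmbedding d α p hp u) (sobolevEmbedding d α p hp v) =
    (∫ x, ν x * -(f x + m * signedPow p (u.1 x)) * v.1 x) +
      ∫ z, a z * -(2⁻¹ * signedPow p (increment u.1 z)) * increment v.1 z
        ∂gagliardoMeasure d α := by
  have hsource : Integrable fun x => ν x * f x * v.1 x := integrable_mul_of_holderConjugate hpq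
    (memLp_bdd_mul hν.aestronglyMeasurable hν.abs_le hf) (Lp.memLp v.1)
  have hmass : Integrable fun x => m * ν x * (signedPow p (u.1 x) * v.1 x) := by
    simpa only [mul_assoc] using (hν.integrable_mul
      (integrable_signedPow_mul hp (Lp.memLp u.1) (Lp.memLp v.1))).const_mul m
  have hcollect : (-∫ x, ν x * f x * v.1 x) - ∫ x, m * ν x * (signedPow p (u.1 x) * v.1 x) =
      ∫ x, ν x * -(f x + m * signedPow p (u.1 x)) * v.1 x := by
    rw [neg_sub_left, ← integral_add hmass hsource, ← integral_neg]
    exact integral_congr_ae (.of_forall fun x => by ring)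
  rw [weightedForm_sobolevEmbedding (IsElliptic.sumWeight hm hν ha), ← sub_sub, hcollect,
    sub_eq_add_neg, ← integral_neg]
  congr 2 with z
  ring

theorem tendsto_sobolevNorm_sub (hα : 0 < α) (hm : 0 < m) (hpq : p.HolderConjugate q)
    {ι : Type*} {l : Filter ι} [l.IsCountablyGenerated] {M M' : ℝ} {n : ι → Rd d → ℝ}
    {Λ : ι → Rd d → Rd d → ℝ} {Λ₀ : Rd d → Rd d → ℝ}
    (hn : ∀ᶠ i in l, IsElliptic volume c C (n i))
    (ha : ∀ᶠ i in l, IsElliptic volume c' C' fun z : Rd d × Rd d => n i z.1 * Λ i z.1 z.2)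
    (hν : IsElliptic volume c C ν)
    (ha₀ : IsElliptic volume c' C' fun z : Rd d × Rd d => ν z.1 * Λ₀ z.1 z.2)
    (hnlim : TendstoWeakStarZero volume M l fun i x => n i x - ν x)
    (halim : TendstoWeakStarZero volume M' l fun i (z : Rd d × Rd d) =>
      n i z.1 * Λ i z.1 z.2 - ν z.1 * Λ₀ z.1 z.2)
    (hf : MemLp f (ENNReal.ofReal q)) {u : ι → Sobolev d α p hp} {u₀ : Sobolev d α p hp}
    (hu : ∀ᶠ i in l, IsWeakSolution m (Λ i) (n i) f (u i)) (hu₀ : IsWeakSolution m Λ₀ ν f u₀) :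
    Tendsto (fun i => sobolevNorm (u i - u₀)) l (𝓝 0) := by
  have : Fact (1 ≤ ENNReal.ofReal p) := ⟨ENNReal.one_le_ofReal.2 hp.le⟩
  have hg : MemLp (fun x => -(f x + m * signedPow p (u₀.1 x))) (ENNReal.ofReal q) :=
    (hf.add ((memLp_signedPow hpq (Lp.memLp u₀.1)).const_mul m)).neg
  have hG : MemLp (fun z => -(2⁻¹ * signedPow p (increment u₀.1 z))) (ENNReal.ofReal q)
      (gagliardoMeasure d α) :=
    ((memLp_signedPow hpq (memLp_increment u₀)).const_mul 2⁻¹).neg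
  have hGm : Measurable fun z => -(2⁻¹ * signedPow p (increment u₀.1 z)) := by
    have := (Lp.stronglyMeasurable u₀.1).measurable
    exact (((continuous_signedPow hp).measurable.comp
      ((this.comp measurable_snd).sub (this.comp measurable_fst))).const_mul 2⁻¹).neg
  have hw₀ := (isWeakSolution_iff (IsElliptic.sumWeight hm hν ha₀)).1 hu₀
  have hform := tendsto_norm_sub_of_dualTendstoZero (D := sobolevEmbedding d α p hp) (u := u)
    (u₀ := u₀) hp (IsElliptic.sumWeight (α := α) hm hν ha₀).pos
    (hn.mp (ha.mono fun i hai hni => IsElliptic.sumWeight hm hni hai))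
  simp only [norm_sobolevEmbedding, ← map_sub] at hform
  refine hform fun τ hτ => ?_
  filter_upwards [hn, ha, hu,
    (hnlim.dualTendstoZero hα hpq hg).add (halim.dualTendstoZero_increment hα hpq hGm hG) τ hτ]
    with i hni hai hui hlim v
  convert hlim v using 2
  have hmass {ν' : Rd d → ℝ} (hν' : IsElliptic volume c C ν') :=
    integrable_mul_of_holderConjugate hpq
      (memLp_bdd_mul hν'.aestronglyMeasurable hν'.abs_le hg) (Lp.memLp v.1)
  have hincr {a : Rd d × Rd d → ℝ} (ha : IsElliptic volume c' C' a) :=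
    integrable_mul_of_holderConjugate hpq
      (memLp_bdd_mul (ha.aestronglyMeasurable.mono_ac gagliardoMeasure_absolutelyContinuous)
        ha.abs_le hG) (memLp_increment v)
  simp only [sub_mul]
  rw [integral_sub (hmass hni) (hmass hν), integral_sub (hincr hai) (hincr ha₀),
    sub_add_sub_comm, ← residual_eq hm hpq hni hai hf, ← residual_eq hm hpq hν ha₀ hf, hw₀ v,
    sub_self, sub_zero, ← (isWeakSolution_iff (IsElliptic.sumWeight hm hni hai)).1 hui v]

lemma norm_le_sobolevNorm (u : Sobolev d α p hp) : ‖u.1‖ ≤ sobolevNorm u :=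
  (norm_eq_lpNorm u.1).trans_le (lpNorm_le_sobolevNorm u)

lemma tendsto_norm_sub_of_tendsto_sobolevNorm {ι : Type*} {l : Filter ι}
    {u : ι → Sobolev d α p hp} {u₀ : Sobolev d α p hp}
    (h : Tendsto (fun i => sobolevNorm (u i - u₀)) l (𝓝 0)) :
    Tendsto (fun i => ‖(u i).1 - u₀.1‖) l (𝓝 0) :=
  squeeze_zero (fun _ => (norm_eq_lpNorm _).trans_ge lpNorm_nonneg)
    (fun i => norm_le_sobolevNorm (u i - u₀)) h

lemma weakTendsto_of_tendsto_sobolevNorm {ι : Type*} {l : Filter ι} {u : ι → Sobolev d α p hp}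
    {u₀ : Sobolev d α p hp} (h : Tendsto (fun i => sobolevNorm (u i - u₀)) l (𝓝 0)) :
    WeakTendsto u l u₀ := by
  rintro ℓ ⟨K, hK⟩
  rw [tendsto_iff_norm_sub_tendsto_zero]
  refine squeeze_zero (fun _ => norm_nonneg _) (fun i => ?_) (by simpa using h.const_mul K)
  rw [← map_sub]
  exact hK _

lemma isWeakSolution_const_weight_iff {n₀ : ℝ} (hn₀ : n₀ ≠ 0) {Λ : Rd d → Rd d → ℝ}
    {u : Sobolev d α p hp} :
    IsWeakSolution m Λ (fun _ => n₀) f u ↔ IsWeakSolution m Λ (fun _ => 1) f u := by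
  refine forall_congr' fun v => ?_
  have henergy : energyForm α p (fun x y => n₀ * Λ x y) u.1 v.1 =
      n₀ * energyForm α p (fun x y => 1 * Λ x y) u.1 v.1 := by
    simp only [energyForm, one_mul]
    rw [mul_left_comm, ← integral_const_mul n₀]
    congr 2 with z
    ring
  simp only [henergy, integral_mul_const, mul_one]
  refine ⟨fun h => mul_left_cancel₀ hn₀ ?_, fun h => ?_⟩
  · linear_combination h
  · linear_combination n₀ * h

end Solutions

/-! ### The unit cube as a period cell -/

section UnitCube

variable {d : ℕ}

/-- The standard basis of `ℝ^d`. -/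
def stdBasis (d : ℕ) : Module.Basis (Fin d) ℝ (Rd d) := (EuclideanSpace.basisFun (Fin d) ℝ).toBasis

lemma stdBasis_apply (i : Fin d) : stdBasis d i = EuclideanSpace.single i 1 := by
  simp [stdBasis]

lemma fundamentalDomain_stdBasis :
    ZSpan.fundamentalDomain (stdBasis d) = (MeasurableEquiv.toLp 2 (Fin d → ℝ)).symm ⁻¹'
      Set.univ.pi fun _ => Set.Ico (0 : ℝ) 1 := by
  ext ξ
  simp [ZSpan.mem_fundamentalDomain, stdBasis]

lemma unitCube_eq_preimage : unitCube d = (MeasurableEquiv.toLp 2 (Fin d → ℝ)).symm ⁻¹'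
    Set.Icc (fun _ => (0 : ℝ)) fun _ => 1 := by
  ext ξ
  simp [unitCube, Pi.le_def, forall_and]

lemma fundamentalDomain_ae_eq_unitCube :
    ZSpan.fundamentalDomain (stdBasis d) =ᵐ[volume] unitCube d := by
  rw [fundamentalDomain_stdBasis, unitCube_eq_preimage]
  exact (EuclideanSpace.volume_preserving_symm_measurableEquiv_toLp
    (Fin d)).quasiMeasurePreserving.preimage_ae_eq Measure.univ_pi_Ico_ae_eq_Icc

lemma volume_unitCube : volume (unitCube d) = 1 := by
  rw [unitCube_eq_preimage, (EuclideanSpace.volume_preserving_symm_measurableEquiv_toLp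
    (Fin d)).measure_preimage_equiv, Real.volume_Icc_pi]
  simp

instance : IsProbabilityMeasure (volume.restrict (unitCube d)) :=
  ⟨Measure.restrict_apply_univ (unitCube d) ▸ volume_unitCube⟩

instance : IsProbabilityMeasure (volume.restrict (ZSpan.fundamentalDomain (stdBasis d))) := by
  rw [Measure.restrict_congr_set fundamentalDomain_ae_eq_unitCube]
  infer_instance

lemma restrict_fundamentalDomain_prod :
    (volume : Measure (Rd d × Rd d)).restrict
      (ZSpan.fundamentalDomain ((stdBasis d).prod (stdBasis d))) =
    (volume.restrict (unitCube d)).prod (volume.restrict (unitCube d)) := by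
  have hprod : ZSpan.fundamentalDomain ((stdBasis d).prod (stdBasis d)) =
      ZSpan.fundamentalDomain (stdBasis d) ×ˢ ZSpan.fundamentalDomain (stdBasis d) := by
    ext z
    simp [ZSpan.mem_fundamentalDomain]
  rw [hprod, Measure.volume_eq_prod, ← Measure.prod_restrict,
    Measure.restrict_congr_set fundamentalDomain_ae_eq_unitCube]

instance : IsProbabilityMeasure ((volume : Measure (Rd d × Rd d)).restrict
    (ZSpan.fundamentalDomain ((stdBasis d).prod (stdBasis d)))) := by
  rw [restrict_fundamentalDomain_prod]
  infer_instance

instance : (volume : Measure (Rd d × Rd d)).IsAddHaarMeasure :=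
  Measure.prod.instIsAddHaarMeasure volume volume

lemma setIntegral_fundamentalDomain_prod {C : ℝ} {F : Rd d × Rd d → ℝ}
    (hF : AEMeasurable F volume) (hC : ∀ w, |F w| ≤ C) :
    ∫ w in ZSpan.fundamentalDomain ((stdBasis d).prod (stdBasis d)), F w =
      ∫ η in unitCube d, ∫ ξ in unitCube d, F (ξ, η) := by
  have hint : Integrable F (volume.restrict
      (ZSpan.fundamentalDomain ((stdBasis d).prod (stdBasis d)))) :=
    .of_bound hF.aestronglyMeasurable.restrict C (.of_forall hC)
  rw [restrict_fundamentalDomain_prod] at hint ⊢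
  exact integral_prod_symm _ hint

end UnitCube

/-! ### Homogenization -/

section Ellipticity

variable {E ι : Type*} [NormedAddCommGroup E] [NormedSpace ℝ E] [FiniteDimensional ℝ E]
  [MeasurableSpace E] [BorelSpace E] {μ : Measure E} [μ.IsAddHaarMeasure]
  {b : Module.Basis ι ℝ E} {c C : ℝ} {A : E → E → ℝ}

lemma IsOscillating.isElliptic_diag (hA : IsOscillating μ b C A) (hc : 0 < c)
    (hlower : ∀ z ζ, c ≤ A z ζ) {ε : ℝ} (hε : ε ≠ 0) :
    IsElliptic μ c C fun z => A z (ε⁻¹ • z) where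
  pos := hc
  aestronglyMeasurable := hA.aestronglyMeasurable_diag hε
  lower z := hlower z _
  upper z := le_of_abs_le (hA.bound z _)

lemma IsOscillating.isElliptic_mean
    [IsProbabilityMeasure (μ.restrict (ZSpan.fundamentalDomain b))]
    (hA : IsOscillating μ b C A) (hc : 0 < c) (hlower : ∀ z ζ, c ≤ A z ζ) :
    IsElliptic μ c C fun z => ∫ ζ in ZSpan.fundamentalDomain b, A z ζ ∂μ where
  pos := hc
  aestronglyMeasurable := hA.aestronglyMeasurable_mean _
  lower z := by
    have hint : Integrable (A z) (μ.restrict (ZSpan.fundamentalDomain b)) :=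
      .of_bound (hA.aemeasurable z).aestronglyMeasurable.restrict C (.of_forall (hA.bound z))
    simpa using integral_mono (integrable_const c) hint (hlower z)
  upper z := le_of_abs_le (hA.abs_mean_le z)

end Ellipticity

section Homogenization

variable {d : ℕ} {α p m γ : ℝ}

lemma mul_mem_Icc_inv (hγ : 0 < γ) {s t : ℝ} (hs : s ∈ Set.Icc γ⁻¹ γ) (ht : t ∈ Set.Icc γ⁻¹ γ) :
    s * t ∈ Set.Icc (γ⁻¹ * γ⁻¹) (γ * γ) := by
  have hγi := inv_pos.2 hγ
  exact ⟨mul_le_mul hs.1 ht.1 hγi.le (hγi.le.trans hs.1),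
    mul_le_mul hs.2 ht.2 (hγi.le.trans ht.1) hγ.le⟩

namespace Coefficient

/-- The periodic function `n` with `ν^ε x = n (x/ε)`. -/
def cellWeight : Coefficient d → Rd d → ℝ
  | .product lam mu => fun ξ => mu ξ / lam ξ
  | .locallyPeriodic _ => fun _ => 1

/-- The function `A` of slow variables `z = (x, y)` and fast variables `ζ = (ξ, η)` for which the
symmetrized kernel `ν^ε x * Λ^ε (x, y)` is `A z (z/ε)`. -/
def symmKernel : Coefficient d → Rd d × Rd d → Rd d × Rd d → ℝ
  | .product _ mu => fun _ ζ => mu ζ.1 * mu ζ.2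
  | .locallyPeriodic Λ => fun z ζ => Λ z.1 z.2 ζ.1 ζ.2

lemma weight_eq (K : Coefficient d) (ε : ℝ) : K.weight ε = fun x => K.cellWeight (ε⁻¹ • x) := by
  cases K <;> rfl

namespace Admissible

variable {K : Coefficient d}

lemma weight_mul_kernel (hK : K.Admissible γ) (hγ : 0 < γ) (ε : ℝ) (z : Rd d × Rd d) :
    K.weight ε z.1 * K.kernel ε z.1 z.2 = K.symmKernel z (ε⁻¹ • z) := by
  cases K with
  | product lam mu =>
    obtain ⟨-, -, -, -, hlam, -⟩ := hK
    have hlam0 : lam (ε⁻¹ • z.1) ≠ 0 := ((inv_pos.2 hγ).trans_le (hlam _).1).ne'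
    simp only [weight, kernel, symmKernel, ← mul_assoc, div_mul_cancel₀ _ hlam0, Prod.smul_fst,
      Prod.smul_snd]
  | locallyPeriodic Λ => exact one_mul _

lemma one_le (hK : K.Admissible γ) (hγ : 0 < γ) : 1 ≤ γ := by
  have hle : γ⁻¹ ≤ γ := by
    cases K with
    | product lam mu =>
      obtain ⟨-, -, -, -, hlam, -⟩ := hK
      exact (hlam 0).1.trans (hlam 0).2
    | locallyPeriodic Λ =>
      obtain ⟨-, -, -, -, -, hΛ⟩ := hK
      exact (hΛ 0 0 0 0).1.trans (hΛ 0 0 0 0).2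
  by_contra! hlt
  exact (hle.trans_lt hlt).not_gt ((one_lt_inv₀ hγ).2 hlt)

lemma cellWeight_mem_Icc (hK : K.Admissible γ) (hγ : 0 < γ) (ξ : Rd d) :
    K.cellWeight ξ ∈ Set.Icc (γ⁻¹ * γ⁻¹) (γ * γ) := by
  have hγi := inv_pos.2 hγ
  cases K with
  | product lam mu =>
    obtain ⟨-, -, -, -, hlam, hmu⟩ := hK
    have hinv : (lam ξ)⁻¹ ∈ Set.Icc γ⁻¹ γ :=
      ⟨inv_anti₀ (hγi.trans_le (hlam ξ).1) (hlam ξ).2, inv_le_of_inv_le₀ hγ (hlam ξ).1⟩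
    simpa only [cellWeight, div_eq_mul_inv] using mul_mem_Icc_inv hγ (hmu ξ) hinv
  | locallyPeriodic Λ =>
    have h1 : 1 ∈ Set.Icc γ⁻¹ γ := ⟨inv_le_one_of_one_le₀ (hK.one_le hγ), hK.one_le hγ⟩
    simpa only [cellWeight, mul_one] using mul_mem_Icc_inv hγ h1 h1

lemma symmKernel_mem_Icc (hK : K.Admissible γ) (hγ : 0 < γ) (z ζ : Rd d × Rd d) :
    K.symmKernel z ζ ∈ Set.Icc (γ⁻¹ * γ⁻¹) (γ * γ) := by
  have hγ1 := hK.one_le hγ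
  cases K with
  | product lam mu =>
    obtain ⟨-, -, -, -, -, hmu⟩ := hK
    exact mul_mem_Icc_inv hγ (hmu ζ.1) (hmu ζ.2)
  | locallyPeriodic Λ =>
    obtain ⟨-, -, -, -, -, hΛ⟩ := hK
    have h1 : 1 ∈ Set.Icc γ⁻¹ γ := ⟨inv_le_one_of_one_le₀ hγ1, hγ1⟩
    simpa only [symmKernel, mul_one] using mul_mem_Icc_inv hγ (hΛ z.1 z.2 ζ.1 ζ.2) h1

lemma isOscillating_cellWeight (hK : K.Admissible γ) (hγ : 0 < γ) :
    IsOscillating volume (stdBasis d) (γ * γ) fun _ => K.cellWeight where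
  continuous _ := continuous_const
  aemeasurable _ := by
    cases K with
    | product lam mu => exact hK.2.1.div hK.1
    | locallyPeriodic Λ => exact aemeasurable_const
  periodic _ i ξ := by
    cases K with
    | product lam mu =>
      obtain ⟨-, -, hlam, hmu, -⟩ := hK
      simp only [cellWeight, stdBasis_apply, hlam i ξ, hmu i ξ]
    | locallyPeriodic Λ => rfl
  bound _ ξ := by
    have h := hK.cellWeight_mem_Icc hγ ξ
    exact (abs_of_pos ((mul_pos (inv_pos.2 hγ) (inv_pos.2 hγ)).trans_le h.1)).trans_le h.2

lemma aemeasurable_symmKernel (hK : K.Admissible γ) (z : Rd d × Rd d) :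
    AEMeasurable (K.symmKernel z) volume := by
  cases K with
  | product lam mu =>
    exact (hK.2.1.comp_quasiMeasurePreserving Measure.quasiMeasurePreserving_fst).mul
      (hK.2.1.comp_quasiMeasurePreserving Measure.quasiMeasurePreserving_snd)
  | locallyPeriodic Λ => exact hK.2.1 z.1 z.2

lemma isOscillating_symmKernel (hK : K.Admissible γ) (hγ : 0 < γ) :
    IsOscillating volume ((stdBasis d).prod (stdBasis d)) (γ * γ) K.symmKernel where
  continuous ζ := by
    cases K with
    | product lam mu => exact continuous_const
    | locallyPeriodic Λ => exact hK.1 ζ.1 ζ.2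
  aemeasurable := hK.aemeasurable_symmKernel
  periodic z i ζ := by
    cases K with
    | product lam mu =>
      obtain ⟨-, -, -, hmu, -⟩ := hK
      cases i <;> simp [symmKernel, stdBasis_apply, hmu _ _]
    | locallyPeriodic Λ =>
      obtain ⟨-, -, hξ, hη, -⟩ := hK
      cases i with
      | inl i => simpa [symmKernel, stdBasis_apply] using hξ z.1 z.2 ζ.2 i ζ.1
      | inr i => simpa [symmKernel, stdBasis_apply] using hη z.1 z.2 ζ.1 i ζ.2
  bound z ζ := by
    have h := hK.symmKernel_mem_Icc hγ z ζ
    exact (abs_of_pos ((mul_pos (inv_pos.2 hγ) (inv_pos.2 hγ)).trans_le h.1)).trans_le h.2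

lemma isElliptic_mean_cellWeight (hK : K.Admissible γ) (hγ : 0 < γ) :
    IsElliptic volume (γ⁻¹ * γ⁻¹) (γ * γ) fun _ : Rd d => ∫ ξ in unitCube d, K.cellWeight ξ := by
  rw [← setIntegral_congr_set fundamentalDomain_ae_eq_unitCube]
  exact (hK.isOscillating_cellWeight hγ).isElliptic_mean
    (mul_pos (inv_pos.2 hγ) (inv_pos.2 hγ)) fun _ ξ => (hK.cellWeight_mem_Icc hγ ξ).1

lemma mean_cellWeight_mul_effective (hK : K.Admissible γ) (hγ : 0 < γ) (z : Rd d × Rd d) :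
    (∫ ξ in unitCube d, K.cellWeight ξ) * K.effective z.1 z.2 =
      ∫ ζ in ZSpan.fundamentalDomain ((stdBasis d).prod (stdBasis d)), K.symmKernel z ζ := by
  have hν := hK.isElliptic_mean_cellWeight hγ
  have hn₀ : (∫ ξ in unitCube d, K.cellWeight ξ) ≠ 0 := (hν.pos.trans_le (hν.lower 0)).ne'
  rw [setIntegral_fundamentalDomain_prod (hK.aemeasurable_symmKernel z)
    ((hK.isOscillating_symmKernel hγ).bound z)]
  cases K with
  | product lam mu =>
    simp only [symmKernel, integral_const_mul, integral_mul_const, ← sq]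
    exact mul_inv_cancel_left₀ hn₀ _
  | locallyPeriodic Λ => simp [cellWeight, symmKernel, effective]

end Admissible

end Coefficient

theorem theorem1p2_general (hα : 0 < α) (hp : 1 < p) (hm : 0 < m) (hγ : 0 < γ)
    (K : Coefficient d) (hK : K.Admissible γ) (f : Rd d → ℝ)
    (hf : MemLp f (ENNReal.ofReal (p / (p - 1)))) :
    (∀ ε : ℝ, 0 < ε → ∃! u : Sobolev d α p hp,
      IsWeakSolution m (K.kernel ε) (K.weight ε) f u) ∧
    (∃! u₀ : Sobolev d α p hp, IsWeakSolution m K.effective (fun _ => 1) f u₀) ∧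
    ∀ (u : ℝ → Sobolev d α p hp) (u₀ : Sobolev d α p hp),
      (∀ ε : ℝ, 0 < ε → IsWeakSolution m (K.kernel ε) (K.weight ε) f (u ε)) →
      IsWeakSolution m K.effective (fun _ => 1) f u₀ →
      Tendsto (fun ε => sobolevNorm (u ε - u₀)) (𝓝[>] 0) (𝓝 0) := by
  have hpq := Real.HolderConjugate.conjExponent hp
  have hc : 0 < γ⁻¹ * γ⁻¹ := mul_pos (inv_pos.2 hγ) (inv_pos.2 hγ)
  have hn := hK.isOscillating_cellWeight hγ
  have hA := hK.isOscillating_symmKernel hγ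
  have hν (ε : ℝ) (hε : 0 < ε) : IsElliptic volume (γ⁻¹ * γ⁻¹) (γ * γ) (K.weight ε) := by
    simpa only [K.weight_eq] using
      hn.isElliptic_diag hc (fun _ ξ => (hK.cellWeight_mem_Icc hγ ξ).1) hε.ne'
  have ha (ε : ℝ) (hε : 0 < ε) : IsElliptic volume (γ⁻¹ * γ⁻¹) (γ * γ) fun z : Rd d × Rd d =>
      K.weight ε z.1 * K.kernel ε z.1 z.2 := by
    simpa only [hK.weight_mul_kernel hγ] using
      hA.isElliptic_diag hc (fun z ζ => (hK.symmKernel_mem_Icc hγ z ζ).1) hε.ne'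
  have hν₀ := hK.isElliptic_mean_cellWeight hγ
  have ha₀ : IsElliptic volume (γ⁻¹ * γ⁻¹) (γ * γ) fun z : Rd d × Rd d =>
      (∫ ξ in unitCube d, K.cellWeight ξ) * K.effective z.1 z.2 := by
    simpa only [hK.mean_cellWeight_mul_effective hγ] using
      hA.isElliptic_mean hc fun z ζ => (hK.symmKernel_mem_Icc hγ z ζ).1
  have hνlim : TendstoWeakStarZero volume (γ * γ + γ * γ) (𝓝[>] 0) fun ε x =>
      K.weight ε x - ∫ ξ in unitCube d, K.cellWeight ξ := by
    simpa only [K.weight_eq, setIntegral_congr_set fundamentalDomain_ae_eq_unitCube] using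
      hn.tendstoWeakStarZero
  have halim := hA.tendstoWeakStarZero
  simp only [← hK.mean_cellWeight_mul_effective hγ, ← hK.weight_mul_kernel hγ] at halim
  simp only [← isWeakSolution_const_weight_iff (hν₀.pos.trans_le (hν₀.lower 0)).ne']
  refine ⟨fun ε hε => existsUnique_isWeakSolution hm hpq (hν ε hε) (ha ε hε) hf,
    existsUnique_isWeakSolution hm hpq hν₀ ha₀ hf, fun u u₀ hu hu₀ => ?_⟩
  have hpos : ∀ᶠ ε : ℝ in 𝓝[>] 0, 0 < ε := eventually_mem_nhdsWithin
  exact tendsto_sobolevNorm_sub hα hm hpq (hpos.mono hν) (hpos.mono ha) hν₀ ha₀ hνlim halim hf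
    (hpos.mono hu) hu₀

end Homogenization

end NonlocalHomogenization

end

theorem theorem1p2 {d : ℕ} (hd : 0 < d) {α p m γ : ℝ} (hα : 0 < α) (hα2 : α < 2)
    (hp : 1 < p) (hm : 0 < m) (hγ : 1 < γ)
    (K : NonlocalHomogenization.Coefficient d) (hK : K.Admissible γ)
    (f : NonlocalHomogenization.Rd d → ℝ)
    (hf : MemLp f (ENNReal.ofReal (p / (p - 1))) volume) :
    (∀ ε : ℝ, 0 < ε → ∃! u : NonlocalHomogenization.Sobolev d α p hp,
      NonlocalHomogenization.IsWeakSolution m (K.kernel ε) (K.weight ε) f u) ∧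
    (∃! u₀ : NonlocalHomogenization.Sobolev d α p hp,
      NonlocalHomogenization.IsWeakSolution m K.effective (fun _ => 1) f u₀) ∧
    ∀ (u : ℝ → NonlocalHomogenization.Sobolev d α p hp)
      (u₀ : NonlocalHomogenization.Sobolev d α p hp),
      (∀ ε : ℝ, 0 < ε →
        NonlocalHomogenization.IsWeakSolution m (K.kernel ε) (K.weight ε) f (u ε)) →
      NonlocalHomogenization.IsWeakSolution m K.effective (fun _ => 1) f u₀ →
      Tendsto (fun ε => ‖(u ε).1 - u₀.1‖) (𝓝[>] 0) (𝓝 0) ∧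
      NonlocalHomogenization.WeakTendsto u (𝓝[>] 0) u₀ := by
  obtain ⟨hex, hex₀, hlim⟩ := NonlocalHomogenization.theorem1p2_general hα hp hm (one_pos.trans hγ)
    K hK f hf
  exact ⟨hex, hex₀, fun u u₀ hu hu₀ =>
    ⟨NonlocalHomogenization.tendsto_norm_sub_of_tendsto_sobolevNorm (hlim u u₀ hu hu₀),
      NonlocalHomogenization.weakTendsto_of_tendsto_sobolevNorm (hlim u u₀ hu hu₀)⟩⟩
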